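/- Let $q$ be a prime power and $n\ge 0$, and let $G=\mathbb{F}_q^n$. For $f,g:G\to\mathbb{R}$ write $\langle f,g\rangle=\frac{1}{|G|}\sum_{x\in G}f(x)g(x)$, $f*g(x)=\frac{1}{|G|}\sum_{y\in G}f(y)g(x-y)$ and $\|f\|_\infty=\max_{x\in G}|f(x)|$. For a nonempty set $A\subseteq G$ of density $\alpha=|A|/|G|$ write $1_A$ for its indicator function and $\mu_A=\alpha^{-1}1_A$. There is an absolute constant $c>0$, and for every $\epsilon\in(0,1)$ a constant $K_\epsilon>0$ depending only on $\epsilon$, such that the following holds for all $q$ and $n$. Let $A,C\subseteq\mathbb{F}_q^n$, where $A$ is nonempty with density $\alpha$, and $C$ has density at least $\gamma>0$. Then either 1. $|\langle\mu_A*\mu_A,\mu_C\rangle-1|\le\epsilon$, or 2. there is a linear subspace $V\le\mathbb{F}_q^n$ of codimension at most $K_\epsilon\,\log(2/\gamma)^4\log(2/\alpha)^4$ such that $\|1_A*\mu_V\|_\infty\ge(1+c\,\epsilon)\,\alpha$. -/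

import Mathlib

open scoped BigOperators

noncomputable section

namespace KelleyMeka

variable {G : Type*} [Fintype G]

/-- The density `|A| / |G|` of a subset `A` of a finite set `G`. -/
def density (A : Set G) : ℝ := (A.ncard : ℝ) / (Fintype.card G : ℝ)

/-- The indicator function `1_A`. -/
def ind (A : Set G) : G → ℝ := A.indicator 1

/-- The normalised indicator function `μ_A = α⁻¹ 1_A`, where `α` is the density of `A`. -/
def mu (A : Set G) : G → ℝ := fun x => (density A)⁻¹ * ind A x

/-- The inner product `⟨f, g⟩ = 𝔼 x, f x * g x` of real functions, for the uniform
probability measure on `G`. -/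
def ip (f g : G → ℝ) : ℝ := Finset.expect Finset.univ fun x => f x * g x

/-- The convolution `f ∗ g (x) = 𝔼 y, f y * g (x - y)`. -/
def conv [AddCommGroup G] (f g : G → ℝ) : G → ℝ :=
  fun x => Finset.expect Finset.univ fun y => f y * g (x - y)

/-- The norm `‖f‖_∞ = max_x |f x|`. -/
def supNorm (f : G → ℝ) : ℝ := ⨆ x, |f x|

/-- The abbreviation `log (2 / t)`. -/
def logTwoDiv (t : ℝ) : ℝ := Real.log (2 / t)

/-- The codimension of a subspace `V` of `F ^ n`. -/
def codim {F : Type*} [Field F] {n : ℕ} (V : Submodule F (Fin n → F)) : ℕ :=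
  Module.finrank F ((Fin n → F) ⧸ V)

end KelleyMeka

end

open scoped BigOperators

namespace KelleyMeka

/-! ### Moments of correlations and convolutions -/

section Moments

variable {G : Type*} [Fintype G] [AddCommGroup G]

/-! The argument follows Kelley and Meka. Put f = μ_A - 1 and suppose the first alternative fails.
By Hölder on C, f * f has a large moment of even order 2m, with m of order log(2/γ) for fixed ε, and
`sum_conv_pow_le_sum_corr_pow` passes this to the correlation g = f ∘ f. All moments of g are
nonnegative, so the binomial expansion of (1 + g)^n shows that a high moment of μ_A ∘ μ_A = 1 + g is
exponentially large (`le_sum_corrCount_pow`). Sifting (`exists_sift`) turns this into structure: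
some intersection B of n translates of A has density at least α^n / 2, while almost all pairs in B
have a popular difference, one represented in A - A more than 1 + ε/16 times as often as average.

It remains to smooth this along a subspace. Let h be the indicator of popular differences averaged
over translates of -B. Croot–Sisask sampling gives a dense set T of almost periods of h. Averaging
repeatedly over T changes h little on B and damps every frequency outside the large spectrum of T;
by Chang's inequality that spectrum is annihilated by a subspace V of small codimension. The cost is
O(log(2/β)^4) for B of density β (`exists_submodule_codim_le_log_pow`), and log(2/β) is at most a
constant times log(2/γ) log(2/α). Popularity that persists along V forces A to be denser on a
translate of V (`density_increment`). -/

omit [AddCommGroup G] in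
lemma sum_pow_eq_sum_prod_mul_prod (f : G → ℝ) (e : G → G → G) (k : ℕ) :
    ∑ x, (∑ y, f y * f (e x y)) ^ k =
      ∑ x, ∑ y : Fin k → G, (∏ i, f (y i)) * ∏ i, f (e x (y i)) := by
  refine Finset.sum_congr rfl fun x _ => ?_
  rw [Fintype.sum_pow]
  exact Finset.sum_congr rfl fun y _ => Finset.prod_mul_distrib

/-- Shifting the tuple `y` by the diagonal `x`, and `z` by `e' x z` to compensate, makes the summand
independent of `x`. Correlation takes `e' x z = x`, convolution takes `e' x z = -x`. -/
lemma sum_diagonal_translates_mul (f : G → ℝ) (k : ℕ) (e e' : G → G → G)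
    (he : ∀ x z y, e (z + e' x z) (y - x) = e z y) (he' : ∀ x, ∃ σ : G ≃ G, ∀ z, σ z = z + e' x z) :
    ∑ y : Fin k → G, (∑ x, ∏ i, f (x + y i)) * ∑ z, ∏ i, f (e z (y i)) =
      (Fintype.card G : ℝ) * ∑ x, (∑ y, f y * f (e x y)) ^ k := by
  rw [sum_pow_eq_sum_prod_mul_prod, ← nsmul_eq_mul, ← Finset.card_univ, ← Finset.sum_const]
  simp_rw [Finset.sum_mul_sum]
  rw [Finset.sum_comm]
  refine Finset.sum_congr rfl fun x _ => ?_
  rw [Finset.sum_comm]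
  obtain ⟨σ, hσ⟩ := he' x
  rw [← Equiv.sum_comp σ]
  refine Finset.sum_congr rfl fun z _ => ?_
  rw [← Equiv.sum_comp (Equiv.subRight (fun _ : Fin k => x))]
  refine Finset.sum_congr rfl fun y _ => ?_
  simp [hσ, he]

lemma card_mul_sum_corr_pow (f : G → ℝ) (k : ℕ) :
    (Fintype.card G : ℝ) * ∑ x, (∑ y, f y * f (x + y)) ^ k =
      ∑ y : Fin k → G, (∑ x, ∏ i, f (x + y i)) ^ 2 := by
  simp_rw [sq]
  exact (sum_diagonal_translates_mul f k (fun x y => x + y) (fun x _ => x)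
    (fun x z y => by abel) fun x => ⟨Equiv.addRight x, fun z => rfl⟩).symm

lemma card_mul_sum_conv_pow (f : G → ℝ) (k : ℕ) :
    (Fintype.card G : ℝ) * ∑ x, (∑ y, f y * f (x - y)) ^ k =
      ∑ y : Fin k → G, (∑ x, ∏ i, f (x + y i)) * ∑ x, ∏ i, f (x - y i) :=
  (sum_diagonal_translates_mul f k (fun x y => x - y) (fun x _ => -x)
    (fun x z y => by abel) fun x => ⟨Equiv.addRight (-x), fun z => rfl⟩).symm

/-- A sum of squares by the identity above, hence nonnegative for odd `k` too; this is what makes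
the binomial expansion usable. -/
lemma sum_corr_pow_nonneg (f : G → ℝ) (k : ℕ) :
    0 ≤ ∑ x, (∑ y, f y * f (x + y)) ^ k := by
  have h := card_mul_sum_corr_pow f k
  have hc : (0 : ℝ) < Fintype.card G := by exact_mod_cast Fintype.card_pos
  refine nonneg_of_mul_nonneg_right (h ▸ Finset.sum_nonneg fun y _ => sq_nonneg _) hc

/-- Up to the factor |G|, the two sides are the sums of H(y)H(-y) and of H(y)², so AM–GM and the
symmetry y ↦ -y suffice. -/
lemma sum_conv_pow_le_sum_corr_pow (f : G → ℝ) (k : ℕ) :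
    ∑ x, (∑ y, f y * f (x - y)) ^ k ≤ ∑ x, (∑ y, f y * f (x + y)) ^ k := by
  have hc : (0 : ℝ) < Fintype.card G := by exact_mod_cast Fintype.card_pos
  refine le_of_mul_le_mul_left ?_ hc
  rw [card_mul_sum_conv_pow, card_mul_sum_corr_pow]
  set H : (Fin k → G) → ℝ := fun y => ∑ x, ∏ i, f (x + y i)
  have h1 : ∀ y : Fin k → G, ∑ x, ∏ i, f (x - y i) = H (-y) := by
    intro y; simp [H, sub_eq_add_neg]
  have h2 : ∑ y, H (-y) ^ 2 = ∑ y, H y ^ 2 := Equiv.sum_comp (Equiv.neg _) fun y => H y ^ 2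
  calc ∑ y, H y * ∑ x, ∏ i, f (x - y i) ≤ ∑ y, (H y ^ 2 + H (-y) ^ 2) / 2 := by
        refine Finset.sum_le_sum fun y _ => ?_
        rw [h1]
        linarith [sq_nonneg (H y - H (-y)), sub_sq (H y) (H (-y))]
    _ = ∑ y, H y ^ 2 := by
        rw [← Finset.sum_div, Finset.sum_add_distrib, h2]; ring

end Moments

lemma div_pow_le_choose {n k : ℕ} (hk : k ≤ n) : ((n : ℝ) / k) ^ k ≤ n.choose k := by
  induction k generalizing n with
  | zero => simp
  | succ k ih =>
    obtain ⟨n, rfl⟩ : ∃ n', n = n' + 1 := ⟨n - 1, by omega⟩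
    rcases Nat.eq_zero_or_pos k with rfl | hk0
    · simp
    have h1 := ih (n := n) (by omega)
    have h2 : ((n + 1).choose (k + 1) : ℝ) = (n + 1) / (k + 1) * n.choose k := by
      have := Nat.add_one_mul_choose_eq n k
      have h3 : ((n : ℝ) + 1) * n.choose k = (n + 1).choose (k + 1) * (k + 1) := by
        exact_mod_cast this
      field_simp
      linarith
    rw [h2, pow_succ, mul_comm]
    push_cast
    refine mul_le_mul_of_nonneg_left (le_trans ?_ h1) (by positivity)
    have hkn : (k : ℝ) ≤ n := by exact_mod_cast (by omega : k ≤ n)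
    have hkp : (0 : ℝ) < k := by exact_mod_cast hk0
    refine pow_le_pow_left₀ (by positivity) ?_ k
    rw [div_le_div_iff₀ (by positivity) hkp]
    nlinarith

/-- If all the power sums of `g` are nonnegative, a large even moment of `g` forces a large moment
of `1 + g`. -/
lemma le_sum_one_add_pow {ι : Type*} [Fintype ι] {g : ι → ℝ} (hg : ∀ k, 0 ≤ ∑ x, g x ^ k)
    {n k : ℕ} (hkn : k ≤ n) : ((n : ℝ) / k) ^ k * ∑ x, g x ^ k ≤ ∑ x, (1 + g x) ^ n := by
  have h : ∑ x, (1 + g x) ^ n = ∑ j ∈ Finset.range (n + 1), (n.choose j : ℝ) * ∑ x, g x ^ j := by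
    simp_rw [add_comm (1 : ℝ), add_pow, one_pow, mul_one, Finset.mul_sum]
    rw [Finset.sum_comm]
    simp_rw [mul_comm]
  rw [h]
  refine (mul_le_mul_of_nonneg_right (div_pow_le_choose hkn) (hg k)).trans ?_
  exact Finset.single_le_sum (f := fun j => (n.choose j : ℝ) * ∑ x, g x ^ j)
    (fun j _ => mul_nonneg (Nat.cast_nonneg _) (hg j)) (Finset.mem_range.2 (by omega))

/-! ### Sifting: intersections of random translates -/

section Sifting

variable {G : Type*} [Fintype G] [AddCommGroup G] [DecidableEq G]

/-- The number of representations of `x` as a difference of elements of `A`. -/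
def corrCount (A : Finset G) (x : G) : ℝ :=
  ∑ y, (if y ∈ A then (1 : ℝ) else 0) * if x + y ∈ A then 1 else 0

lemma corrCount_nonneg (A : Finset G) (x : G) : 0 ≤ corrCount A x :=
  Finset.sum_nonneg fun _ _ => by positivity

/-- The intersection of the translates `A - s i`. -/
def sift (A : Finset G) {k : ℕ} (s : Fin k → G) : Finset G := {y | ∀ i, y + s i ∈ A}

lemma ite_mem_sift (A : Finset G) {k : ℕ} (s : Fin k → G) (y : G) :
    (if y ∈ sift A s then (1 : ℝ) else 0) = ∏ i, if y + s i ∈ A then (1 : ℝ) else 0 := by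
  rw [Finset.prod_ite_zero]
  simp [sift]

lemma sum_card_sift (A : Finset G) (k : ℕ) :
    ∑ s : Fin k → G, ((sift A s).card : ℝ) = Fintype.card G * (A.card : ℝ) ^ k := by
  have h : ∀ s : Fin k → G, ((sift A s).card : ℝ) = ∑ y, ∏ i, if y + s i ∈ A then (1 : ℝ) else 0 := by
    intro s
    simp_rw [← ite_mem_sift]
    simp
  simp_rw [h]
  rw [Finset.sum_comm]
  have h1 : ∀ y : G, ∑ s : Fin k → G, ∏ i, (if y + s i ∈ A then (1 : ℝ) else 0) =
      (∑ t, if y + t ∈ A then (1 : ℝ) else 0) ^ k := fun y =>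
    (Fintype.sum_pow (fun t => if y + t ∈ A then (1 : ℝ) else 0) k).symm
  have h2 : ∀ y : G, ∑ t, (if y + t ∈ A then (1 : ℝ) else 0) = A.card := by
    intro y
    refine (Equiv.sum_comp (Equiv.addLeft y) fun t => if t ∈ A then (1 : ℝ) else 0).trans ?_
    simp
  simp [h1, h2]

/-- A pair `(y, z)` survives in `sift A s` for exactly `corrCount A (y - z) ^ k` tuples `s`. Taking
`u = 1` gives the second moment of the size; an indicator of unpopular differences counts the bad
pairs. -/
lemma sum_sum_sift (A : Finset G) (k : ℕ) (u : G → ℝ) :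
    ∑ s : Fin k → G, ∑ y ∈ sift A s, ∑ z ∈ sift A s, u (y - z) =
      Fintype.card G * ∑ x, u x * corrCount A x ^ k := by
  have h : ∀ s : Fin k → G, ∑ y ∈ sift A s, ∑ z ∈ sift A s, u (y - z) =
      ∑ z, ∑ y, u (y - z) * ∏ i, ((if z + s i ∈ A then (1 : ℝ) else 0) *
        if y + s i ∈ A then (1 : ℝ) else 0) := by
    intro s
    simp_rw [Finset.prod_mul_distrib, ← ite_mem_sift]
    rw [Finset.sum_comm]
    simp
  have h2 : ∀ y z : G, ∑ t, ((if z + t ∈ A then (1 : ℝ) else 0) * if y + t ∈ A then 1 else 0) =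
      corrCount A (y - z) := by
    intro y z
    refine Eq.trans (Finset.sum_congr rfl fun t _ => ?_) (Equiv.sum_comp (Equiv.addLeft z)
      fun t => (if t ∈ A then (1 : ℝ) else 0) * if y - z + t ∈ A then 1 else 0)
    rw [Equiv.coe_addLeft, show y - z + (z + t) = y + t by abel]
  have h3 : ∀ y z : G, ∑ s : Fin k → G, ∏ i, ((if z + s i ∈ A then (1 : ℝ) else 0) *
      if y + s i ∈ A then (1 : ℝ) else 0) = corrCount A (y - z) ^ k := by
    intro y z
    rw [← h2, Fintype.sum_pow]
  simp_rw [h]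
  rw [Finset.sum_comm, ← nsmul_eq_mul, ← Finset.card_univ, ← Finset.sum_const]
  refine Finset.sum_congr rfl fun z _ => ?_
  rw [Finset.sum_comm, ← Equiv.sum_comp (Equiv.subRight z) fun x => u x * corrCount A x ^ k]
  refine Finset.sum_congr rfl fun y _ => ?_
  rw [← Finset.mul_sum, h3]
  rfl

/-- The sum over `s` of |B|² - θ|B| - bad(B)/δ is positive, and a single `s` with a positive term
meets both requirements, since each subtracted quantity is nonnegative. -/
lemma exists_sift (A : Finset G) (k : ℕ) {r δ θ : ℝ} (hr : 0 ≤ r) (hδ : 0 < δ) (hθ : 0 ≤ θ)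
    (h : Fintype.card G * r ^ k / δ + θ * (A.card : ℝ) ^ k < ∑ x, corrCount A x ^ k) :
    ∃ B : Finset G, B.Nonempty ∧ θ ≤ B.card ∧
      ∑ y ∈ B, ∑ z ∈ B, (if corrCount A (y - z) ≤ r then (1 : ℝ) else 0) ≤
        δ * (B.card : ℝ) ^ 2 := by
  have hc : (0 : ℝ) < Fintype.card G := by exact_mod_cast Fintype.card_pos
  set bad : Finset G → ℝ := fun B =>
    ∑ y ∈ B, ∑ z ∈ B, (if corrCount A (y - z) ≤ r then (1 : ℝ) else 0) with hbad
  have hbad0 : ∀ B, 0 ≤ bad B := fun B =>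
    Finset.sum_nonneg fun _ _ => Finset.sum_nonneg fun _ _ => by positivity
  have h1 : ∑ s : Fin k → G, ((sift A s).card : ℝ) ^ 2 =
      Fintype.card G * ∑ x, corrCount A x ^ k := by
    have := sum_sum_sift A k fun _ => 1
    simpa [sq] using this
  have h2 : ∑ s : Fin k → G, bad (sift A s) ≤ Fintype.card G * (Fintype.card G * r ^ k) := by
    have := sum_sum_sift A k fun x => if corrCount A x ≤ r then (1 : ℝ) else 0
    rw [hbad, this]
    refine mul_le_mul_of_nonneg_left ?_ hc.le
    rw [← nsmul_eq_mul, ← Finset.card_univ]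
    refine Finset.sum_le_card_nsmul _ _ _ fun x _ => ?_
    have hx := corrCount_nonneg A x
    split_ifs with hxr
    · rw [one_mul]
      exact pow_le_pow_left₀ hx hxr k
    · rw [zero_mul]
      positivity
  have h3 : 0 < ∑ s : Fin k → G, (((sift A s).card : ℝ) ^ 2 - θ * (sift A s).card -
      bad (sift A s) / δ) := by
    rw [Finset.sum_sub_distrib, Finset.sum_sub_distrib, ← Finset.mul_sum, ← Finset.sum_div, h1,
      sum_card_sift]
    have h4 : (∑ s : Fin k → G, bad (sift A s)) / δ ≤
        Fintype.card G * (Fintype.card G * r ^ k / δ) := by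
      rw [← mul_div_assoc]
      exact div_le_div_of_nonneg_right h2 hδ.le
    nlinarith [mul_lt_mul_of_pos_left h hc]
  obtain ⟨s, hs⟩ : ∃ s : Fin k → G, 0 < ((sift A s).card : ℝ) ^ 2 - θ * (sift A s).card -
      bad (sift A s) / δ := by
    by_contra! hs
    exact absurd h3 (not_lt.2 (Finset.sum_nonpos fun s _ => hs s))
  have hb := hbad0 (sift A s)
  have hb' : 0 ≤ bad (sift A s) / δ := by positivity
  have hB : (0 : ℝ) < (sift A s).card := by
    refine lt_of_le_of_ne (Nat.cast_nonneg _) fun h0 => ?_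
    rw [← h0] at hs
    linarith
  refine ⟨sift A s, ?_, ?_, ?_⟩
  · rw [← Finset.card_pos]
    exact_mod_cast hB
  · by_contra! hlt
    nlinarith
  · have : bad (sift A s) / δ ≤ ((sift A s).card : ℝ) ^ 2 := by nlinarith
    rw [div_le_iff₀ hδ] at this
    linarith

end Sifting

end KelleyMeka

namespace KelleyMeka

/-! ### Random sampling and Croot–Sisask almost periods -/

section Sampling

/-- One-sided Hoeffding inequality for sampling with replacement. -/
lemma card_filter_lt_sum_le {α : Type*} [DecidableEq α] (B : Finset α) {Z : α → ℝ}
    (hZ : ∀ b ∈ B, |Z b| ≤ 1) (hZ0 : ∑ b ∈ B, Z b = 0) (k : ℕ) {η : ℝ} (hη : 0 ≤ η) :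
    (({a ∈ Fintype.piFinset fun _ : Fin k => B | k * η < ∑ i, Z (a i)} : Finset _).card : ℝ) ≤
      Real.exp (-(k * η ^ 2 / 2)) * (B.card : ℝ) ^ k := by
  -- On [-1, 1] the exponential lies below its chord, whose linear part cancels because `Z` sums to
  -- zero.
  have h1 : ∑ b ∈ B, Real.exp (η * Z b) ≤ B.card * Real.exp (η ^ 2 / 2) := by
    calc ∑ b ∈ B, Real.exp (η * Z b) ≤ ∑ b ∈ B, (Real.cosh η + Z b * Real.sinh η) := by
          refine Finset.sum_le_sum fun b hb => ?_
          rw [mul_comm]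
          exact Real.exp_mul_le_cosh_add_mul_sinh (hZ b hb) η
      _ = B.card * Real.cosh η := by
          rw [Finset.sum_add_distrib, ← Finset.sum_mul, hZ0]; simp
      _ ≤ _ := mul_le_mul_of_nonneg_left (Real.cosh_le_exp_half_sq η) (Nat.cast_nonneg _)
  have h2 : (({a ∈ Fintype.piFinset fun _ : Fin k => B | k * η < ∑ i, Z (a i)} : Finset _).card : ℝ)
      * Real.exp (η * (k * η)) ≤ (B.card * Real.exp (η ^ 2 / 2)) ^ k := by
    calc _ = ∑ a ∈ Fintype.piFinset (fun _ : Fin k => B) with k * η < ∑ i, Z (a i),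
            Real.exp (η * (k * η)) := by simp
      _ ≤ ∑ a ∈ Fintype.piFinset (fun _ : Fin k => B) with k * η < ∑ i, Z (a i),
            ∏ i, Real.exp (η * Z (a i)) := by
          refine Finset.sum_le_sum fun a ha => ?_
          rw [← Real.exp_sum, ← Finset.mul_sum]
          exact Real.exp_le_exp.2 (mul_le_mul_of_nonneg_left (Finset.mem_filter.1 ha).2.le hη)
      _ ≤ ∑ a ∈ Fintype.piFinset (fun _ : Fin k => B), ∏ i, Real.exp (η * Z (a i)) :=
          Finset.sum_le_sum_of_subset_of_nonneg (Finset.filter_subset _ _)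
            fun _ _ _ => Finset.prod_nonneg fun _ _ => (Real.exp_pos _).le
      _ = (∑ b ∈ B, Real.exp (η * Z b)) ^ k :=
          (Finset.sum_pow' B (fun b => Real.exp (η * Z b)) k).symm
      _ ≤ _ := pow_le_pow_left₀ (Finset.sum_nonneg fun _ _ => (Real.exp_pos _).le) h1 k
  rw [← le_div_iff₀ (Real.exp_pos _)] at h2
  refine h2.trans (le_of_eq ?_)
  rw [mul_pow, ← Real.exp_nat_mul, mul_div_assoc, ← Real.exp_sub, mul_comm]
  congr 2
  ring

lemma card_filter_lt_abs_sum_le {α : Type*} [DecidableEq α] (B : Finset α) {Z : α → ℝ}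
    (hZ : ∀ b ∈ B, |Z b| ≤ 1) (hZ0 : ∑ b ∈ B, Z b = 0) (k : ℕ) {η : ℝ} (hη : 0 ≤ η) :
    (({a ∈ Fintype.piFinset fun _ : Fin k => B | k * η < |∑ i, Z (a i)|} : Finset _).card : ℝ) ≤
      2 * Real.exp (-(k * η ^ 2 / 2)) * (B.card : ℝ) ^ k := by
  have h1 := card_filter_lt_sum_le B hZ hZ0 k hη
  have h2 := card_filter_lt_sum_le B (Z := fun b => -Z b) (by simpa using hZ) (by simpa using hZ0)
    k hη
  have h3 : ({a ∈ Fintype.piFinset fun _ : Fin k => B | k * η < |∑ i, Z (a i)|} : Finset _) ⊆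
      ({a ∈ Fintype.piFinset fun _ : Fin k => B | k * η < ∑ i, Z (a i)} : Finset _) ∪
      ({a ∈ Fintype.piFinset fun _ : Fin k => B | k * η < ∑ i, -Z (a i)} : Finset _) := by
    intro a ha
    simp only [Finset.mem_union, Finset.mem_filter, Finset.sum_neg_distrib, lt_abs] at ha ⊢
    tauto
  have h4 := (Finset.card_le_card h3).trans (Finset.card_union_le _ _)
  have h5 : (({a ∈ Fintype.piFinset fun _ : Fin k => B | k * η < |∑ i, Z (a i)|} :
      Finset _).card : ℝ) ≤
      ({a ∈ Fintype.piFinset fun _ : Fin k => B | k * η < ∑ i, Z (a i)} : Finset _).card +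
      ({a ∈ Fintype.piFinset fun _ : Fin k => B | k * η < ∑ i, -Z (a i)} : Finset _).card := by
    exact_mod_cast h4
  linarith

variable {G : Type*} [Fintype G] [AddCommGroup G] [DecidableEq G]

/-- The average of `u` over the translates of `-B`. -/
noncomputable def avgSub (B : Finset G) (u : G → ℝ) (x : G) : ℝ :=
  Finset.expect B fun b => u (x - b)

/-- The points at which sampling `avgSub B u` at `a` has error more than `η`. -/
noncomputable def badSet (B : Finset G) (u : G → ℝ) {k : ℕ} (η : ℝ) (a : Fin k → G) : Finset G :=
  {x | k * η < |∑ i, (u (x - a i) - avgSub B u x)|}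

omit [Fintype G] [DecidableEq G] in
lemma avgSub_mem_Icc {B : Finset G} (hB : B.Nonempty) {u : G → ℝ} (hu : ∀ x, u x ∈ Set.Icc 0 1)
    (x : G) : avgSub B u x ∈ Set.Icc 0 1 :=
  ⟨Finset.expect_nonneg fun _ _ => (hu _).1, Finset.expect_le hB fun _ _ => (hu _).2⟩

/-- By Hoeffding at each point, the mean size of the bad set is at most (δ/2)|G|; Markov then
discards at most half of the tuples. -/
lemma half_le_card_good {B : Finset G} (hB : B.Nonempty) {u : G → ℝ}
    (hu : ∀ x, u x ∈ Set.Icc 0 1) (k : ℕ) {η δ : ℝ} (hη : 0 ≤ η)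
    (hδ : 4 * Real.exp (-(k * η ^ 2 / 2)) ≤ δ) :
    (B.card : ℝ) ^ k / 2 ≤ (({a ∈ Fintype.piFinset fun _ : Fin k => B |
      ((badSet B u η a).card : ℝ) ≤ δ * Fintype.card G} : Finset _).card : ℝ) := by
  have hG : (0 : ℝ) < Fintype.card G := by exact_mod_cast Fintype.card_pos
  have hδ0 : 0 < δ := lt_of_lt_of_le (by positivity) hδ
  set Ω := Fintype.piFinset fun _ : Fin k => B
  have hΩ : (Ω.card : ℝ) = (B.card : ℝ) ^ k := by simp [Ω]
  have h1 : ∑ a ∈ Ω, ((badSet B u η a).card : ℝ) ≤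
      Fintype.card G * (δ / 2 * (B.card : ℝ) ^ k) := by
    have : ∑ a ∈ Ω, ((badSet B u η a).card : ℝ) = ∑ x : G,
        (({a ∈ Ω | k * η < |∑ i, (u (x - a i) - avgSub B u x)|} : Finset _).card : ℝ) := by
      simp_rw [badSet, Finset.card_filter]
      push_cast
      exact Finset.sum_comm
    rw [this]
    refine (Finset.sum_le_card_nsmul Finset.univ _ (δ / 2 * (B.card : ℝ) ^ k)
      fun x _ => ?_).trans_eq (by simp)
    refine (card_filter_lt_abs_sum_le B (Z := fun b => u (x - b) - avgSub B u x) ?_ ?_ k hη).trans ?_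
    · intro b _
      have h1 := hu (x - b)
      have h2 := avgSub_mem_Icc hB hu x
      rw [abs_le]
      constructor <;> linarith [h1.1, h1.2, h2.1, h2.2]
    · rw [Finset.sum_sub_distrib, ← Finset.card_smul_expect]
      simp [avgSub]
    · exact mul_le_mul_of_nonneg_right (by linarith) (by positivity)
  have h2 : (({a ∈ Ω | ¬((badSet B u η a).card : ℝ) ≤ δ * Fintype.card G} : Finset _).card : ℝ) *
      (δ * Fintype.card G) ≤ ∑ a ∈ Ω, ((badSet B u η a).card : ℝ) := by
    rw [← nsmul_eq_mul]
    refine (Finset.card_nsmul_le_sum _ (fun a => ((badSet B u η a).card : ℝ)) _ fun a ha => ?_).trans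
      (Finset.sum_le_sum_of_subset_of_nonneg (Finset.filter_subset _ _) fun _ _ _ =>
        Nat.cast_nonneg _)
    exact (not_le.1 (Finset.mem_filter.1 ha).2).le
  have h3 : (({a ∈ Ω | ((badSet B u η a).card : ℝ) ≤ δ * Fintype.card G} : Finset _).card : ℝ) +
      ({a ∈ Ω | ¬((badSet B u η a).card : ℝ) ≤ δ * Fintype.card G} : Finset _).card =
      (B.card : ℝ) ^ k := by
    rw [← hΩ]
    exact_mod_cast Finset.card_filter_add_card_filter_not _
  have h4 : (({a ∈ Ω | ¬((badSet B u η a).card : ℝ) ≤ δ * Fintype.card G} : Finset _).card : ℝ) ≤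
      (B.card : ℝ) ^ k / 2 := by
    refine le_of_mul_le_mul_right (h2.trans (h1.trans (le_of_eq ?_))) (mul_pos hδ0 hG)
    ring
  linarith

/-- Some translation class of `G ^ k` meets a set of tuples at least as often as the average. -/
lemma exists_translates_mem {k : ℕ} (L : Finset (Fin k → G)) :
    ∃ y : Fin k → G, (Fintype.card G : ℝ) * L.card ≤
      ({t | (fun i => y i - t) ∈ L} : Finset G).card * (Fintype.card G : ℝ) ^ k := by
  have h : ∑ y : Fin k → G, (({t | (fun i => y i - t) ∈ L} : Finset G).card : ℝ) =
      Fintype.card G * L.card := by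
    simp_rw [Finset.card_filter]
    push_cast
    rw [Finset.sum_comm, ← nsmul_eq_mul, ← Finset.card_univ, ← Finset.sum_const]
    refine Finset.sum_congr rfl fun t _ => ?_
    refine (Equiv.sum_comp (Equiv.subRight fun _ : Fin k => t)
      fun y => if y ∈ L then (1 : ℝ) else 0).trans ?_
    simp
  by_contra! hlt
  have h2 : ∑ y : Fin k → G, (({t | (fun i => y i - t) ∈ L} : Finset G).card : ℝ) *
      (Fintype.card G : ℝ) ^ k < ∑ y : Fin k → G, (Fintype.card G : ℝ) * L.card :=
    Finset.sum_lt_sum_of_nonempty Finset.univ_nonempty fun y _ => hlt y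
  rw [← Finset.sum_mul, h] at h2
  simp [mul_comm] at h2

/-- Croot–Sisask almost periodicity: `avgSub B u` is almost invariant, off a small set, under all
translations from a large set. -/
lemma exists_almost_periods {B : Finset G} (hB : B.Nonempty) {u : G → ℝ}
    (hu : ∀ x, u x ∈ Set.Icc 0 1) {k : ℕ} (hk : 0 < k) {η δ : ℝ} (hη : 0 ≤ η)
    (hδ : 4 * Real.exp (-(k * η ^ 2 / 2)) ≤ δ) :
    ∃ T : Finset G, T.Nonempty ∧
      (Fintype.card G : ℝ) * ((B.card : ℝ) ^ k / 2) ≤ T.card * (Fintype.card G : ℝ) ^ k ∧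
      ∀ t ∈ T, (({x | 2 * η < |avgSub B u (x + t) - avgSub B u x|} : Finset G).card : ℝ) ≤
        2 * δ * Fintype.card G := by
  have hG : (0 : ℝ) < Fintype.card G := by exact_mod_cast Fintype.card_pos
  have hBc : (0 : ℝ) < B.card := by exact_mod_cast hB.card_pos
  have hL := half_le_card_good hB hu k hη hδ
  set L := ({a ∈ Fintype.piFinset fun _ : Fin k => B |
      ((badSet B u η a).card : ℝ) ≤ δ * Fintype.card G} : Finset _)
  obtain ⟨y, hy⟩ := exists_translates_mem L
  have hy' := (mul_le_mul_of_nonneg_left hL hG.le).trans hy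
  set T' := ({t | (fun i => y i - t) ∈ L} : Finset G) with hT'
  have hT'ne : T'.Nonempty := by
    rw [Finset.nonempty_iff_ne_empty]
    intro h0
    rw [h0] at hy'
    simp only [Finset.card_empty, Nat.cast_zero, zero_mul] at hy'
    exact absurd hy' (not_le.2 (by positivity))
  obtain ⟨t₀, ht₀⟩ := hT'ne
  have hmem : ∀ t, t ∈ T' → ((badSet B u η fun i => y i - t).card : ℝ) ≤ δ * Fintype.card G := by
    intro t ht
    exact (Finset.mem_filter.1 (Finset.mem_filter.1 ht).2).2
  refine ⟨T'.map (Equiv.subRight t₀).toEmbedding, ⟨_, Finset.mem_map_of_mem _ ht₀⟩, ?_, ?_⟩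
  · rw [Finset.card_map]
    exact hy'
  · intro t ht
    obtain ⟨s, hs, rfl⟩ := Finset.mem_map.1 ht
    have hsub : ({x | 2 * η < |avgSub B u (x + (s - t₀)) - avgSub B u x|} : Finset G) ⊆
        (badSet B u η fun i => y i - s) ∪
          (badSet B u η fun i => y i - t₀).map (Equiv.subRight (s - t₀)).toEmbedding := by
      intro x hx
      by_contra hx'
      rw [Finset.mem_union, not_or] at hx'
      obtain ⟨h1, h2⟩ := hx'
      have h2' : x + (s - t₀) ∉ badSet B u η fun i => y i - t₀ := fun hmem => h2 <|
        Finset.mem_map.2 ⟨_, hmem, by simp⟩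
      simp only [badSet, Finset.mem_filter, Finset.mem_univ, true_and, not_lt,
        Finset.sum_sub_distrib, Finset.sum_const, Finset.card_univ, Fintype.card_fin,
        nsmul_eq_mul] at h1 h2' hx
      -- Sampling at `y - t₀` from the point `x + (s - t₀)` uses the same values of `u` as sampling
      -- at `y - s` from `x`, so one sum approximates both averages.
      have h3 : ∀ i, x + (s - t₀) - (y i - t₀) = x - (y i - s) := fun i => by abel
      simp_rw [h3] at h2'
      have hk' : (0 : ℝ) < k := by exact_mod_cast hk
      have h4 : k * |avgSub B u (x + (s - t₀)) - avgSub B u x| ≤ k * (2 * η) := by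
        rw [← abs_of_pos hk', ← abs_mul, abs_of_pos hk', abs_le]
        rw [abs_le] at h1 h2'
        constructor <;> linarith [h1.1, h1.2, h2'.1, h2'.2]
      exact absurd hx (not_lt.2 (le_of_mul_le_mul_left h4 hk'))
    have h5 := (Finset.card_le_card hsub).trans (Finset.card_union_le _ _)
    rw [Finset.card_map] at h5
    have h6 : (({x | 2 * η < |avgSub B u (x + (s - t₀)) - avgSub B u x|} : Finset G).card : ℝ) ≤
        (badSet B u η fun i => y i - s).card + (badSet B u η fun i => y i - t₀).card := by
      exact_mod_cast h5
    have := hmem s hs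
    have := hmem t₀ ht₀
    simp only [Equiv.coe_toEmbedding, Equiv.subRight_apply]
    linarith

/-- The average of `φ` over the translates of `T`. -/
noncomputable def avgAdd (T : Finset G) (φ : G → ℝ) (x : G) : ℝ :=
  Finset.expect T fun t => φ (x + t)

omit [DecidableEq G] in
lemma sum_mul_avgAdd (T : Finset G) (w φ : G → ℝ) :
    ∑ x, w x * avgAdd T φ x = ∑ x, avgSub T w x * φ x := by
  simp_rw [avgAdd, avgSub, Finset.mul_expect, Finset.expect_mul, ← Finset.expect_sum_comm]
  refine Finset.expect_congr rfl fun t _ => ?_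
  refine Eq.trans ?_ (Equiv.sum_comp (Equiv.addRight t) _)
  simp

omit [DecidableEq G] in
lemma abs_sum_mul_le {w d : G → ℝ} {M η δ : ℝ} (hw : ∀ x, 0 ≤ w x) (hwM : ∀ x, w x ≤ M)
    (hw1 : ∑ x, w x = 1) (hη : 0 ≤ η) (hd : ∀ x, |d x| ≤ 1)
    (hbad : (({x | η < |d x|} : Finset G).card : ℝ) ≤ δ) :
    |∑ x, w x * d x| ≤ η + M * δ := by
  have hM : 0 ≤ M := (hw 0).trans (hwM 0)
  calc |∑ x, w x * d x| ≤ ∑ x, |w x * d x| := Finset.abs_sum_le_sum_abs _ _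
    _ ≤ ∑ x, (w x * η + M * if η < |d x| then 1 else 0) := by
        refine Finset.sum_le_sum fun x _ => ?_
        rw [abs_mul, abs_of_nonneg (hw x)]
        have h0 := hw x
        split_ifs with h
        · have := mul_le_mul (hwM x) (hd x) (abs_nonneg _) hM
          linarith [mul_nonneg h0 hη]
        · linarith [mul_le_mul_of_nonneg_left (not_lt.1 h) h0]
    _ = η + M * ({x | η < |d x|} : Finset G).card := by
        rw [Finset.sum_add_distrib, ← Finset.sum_mul, hw1, ← Finset.mul_sum]
        simp
    _ ≤ _ := by gcongr

omit [DecidableEq G] in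
-- By adjointness an average over `T` moves onto the weight, which stays a probability weight
-- bounded by `M`; hence each of the `k` steps costs the same `η + M * δ`.
lemma abs_sum_mul_iterate_avgAdd_sub_le {T : Finset G} (hT : T.Nonempty) {h : G → ℝ}
    (hh : ∀ x, h x ∈ Set.Icc 0 1) {M η δ : ℝ} (hη : 0 ≤ η)
    (hbad : ∀ t ∈ T, (({x | η < |h (x + t) - h x|} : Finset G).card : ℝ) ≤ δ) (k : ℕ) {w : G → ℝ}
    (hw : ∀ x, 0 ≤ w x) (hwM : ∀ x, w x ≤ M) (hw1 : ∑ x, w x = 1) :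
    |∑ x, w x * ((avgAdd T)^[k] h x - h x)| ≤ k * (η + M * δ) := by
  have hone : ∀ {w : G → ℝ}, (∀ x, 0 ≤ w x) → (∀ x, w x ≤ M) → ∑ x, w x = 1 →
      |∑ x, w x * (avgAdd T h x - h x)| ≤ η + M * δ := by
    intro w hw hwM hw1
    have : ∑ x, w x * (avgAdd T h x - h x) =
        Finset.expect T fun t => ∑ x, w x * (h (x + t) - h x) := by
      rw [Finset.expect_sum_comm]
      refine Finset.sum_congr rfl fun x _ => ?_
      rw [← Finset.mul_expect, Finset.expect_sub_distrib, Finset.expect_const hT]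
      rfl
    rw [this]
    refine (Finset.abs_expect_le _ _).trans (Finset.expect_le hT fun t ht => ?_)
    refine abs_sum_mul_le hw hwM hw1 hη (fun x => ?_) (hbad t ht)
    have h1 := hh (x + t)
    have h2 := hh x
    rw [abs_le]
    constructor <;> linarith [h1.1, h1.2, h2.1, h2.2]
  induction k generalizing w with
  | zero => simp
  | succ k ih =>
    have h1 : ∑ x, w x * ((avgAdd T)^[k + 1] h x - h x) =
        ∑ x, avgSub T w x * ((avgAdd T)^[k] h x - h x) + ∑ x, w x * (avgAdd T h x - h x) := by
      simp_rw [Function.iterate_succ_apply', mul_sub, Finset.sum_sub_distrib, sum_mul_avgAdd]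
      ring
    rw [h1]
    have h2 := ih (w := avgSub T w) (fun x => Finset.expect_nonneg fun _ _ => hw _)
      (fun x => Finset.expect_le hT fun _ _ => hwM _) (by
        have := sum_mul_avgAdd T w fun _ => 1
        simp only [mul_one] at this
        rw [← this]
        simp [avgAdd, Finset.expect_const hT, hw1])
    refine (abs_add_le _ _).trans ((add_le_add h2 (hone hw hwM hw1)).trans (le_of_eq ?_))
    push_cast
    ring

end Sampling

end KelleyMeka

namespace KelleyMeka

/-! ### Fourier analysis on F^ι and Chang's inequality -/

section Fourier

open ComplexConjugate

variable {F : Type*} [Field F] [Fintype F] {ι : Type*} [Fintype ι]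

lemma sum_addChar_dotProduct_eq_zero [DecidableEq ι] {ψ : AddChar F ℂ}
    (hψ : ψ ≠ 1) {z : ι → F} (hz : z ≠ 0) :
    ∑ a : ι → F, ψ (a ⬝ᵥ z) = 0 := by
  obtain ⟨c, hc⟩ := AddChar.ne_one_iff.1 hψ
  obtain ⟨i, hi⟩ := Function.ne_iff.1 hz
  have h : ∑ a : ι → F, ψ (a ⬝ᵥ z) = ψ c * ∑ a : ι → F, ψ (a ⬝ᵥ z) := by
    rw [Finset.mul_sum, ← Equiv.sum_comp (Equiv.addLeft (Pi.single i (c / z i)))]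
    refine Finset.sum_congr rfl fun a _ => ?_
    rw [Equiv.coe_addLeft, add_dotProduct, single_dotProduct, div_mul_cancel₀ _ hi,
      AddChar.map_add_eq_mul]
  have h' : (1 - ψ c) * ∑ a : ι → F, ψ (a ⬝ᵥ z) = 0 := by rw [sub_mul, ← h]; ring
  exact (mul_eq_zero.1 h').resolve_left (sub_ne_zero.2 hc.symm)

variable [DecidableEq ι]

/-- The Fourier transform of a real function on `F ^ ι`, with respect to a character of `F`. -/
noncomputable def fourier (ψ : AddChar F ℂ) (u : (ι → F) → ℝ) (a : ι → F) : ℂ :=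
  ∑ x, (u x : ℂ) * ψ (-(a ⬝ᵥ x))

/-- The Fourier coefficient at `a` of the uniform measure on `T`. -/
noncomputable def bias (ψ : AddChar F ℂ) (T : Finset (ι → F)) (a : ι → F) : ℂ :=
  Finset.expect T fun t => ψ (a ⬝ᵥ t)

lemma sum_norm_fourier_sq {ψ : AddChar F ℂ} (hψ : ψ ≠ 1) (u : (ι → F) → ℝ) :
    ∑ a, ‖fourier ψ u a‖ ^ 2 = Fintype.card (ι → F) * ∑ x, u x ^ 2 := by
  have h : ((∑ a, ‖fourier ψ u a‖ ^ 2 : ℝ) : ℂ) =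
      ((Fintype.card (ι → F) * ∑ x, u x ^ 2 : ℝ) : ℂ) := by
    push_cast
    calc ∑ a, (‖fourier ψ u a‖ : ℂ) ^ 2
        = ∑ a : ι → F, ∑ x, ∑ y, (u x : ℂ) * u y * ψ (a ⬝ᵥ (y - x)) := by
          refine Finset.sum_congr rfl fun a _ => ?_
          rw [← Complex.mul_conj', fourier, map_sum, Finset.sum_mul_sum]
          refine Finset.sum_congr rfl fun x _ => Finset.sum_congr rfl fun y _ => ?_
          rw [map_mul, Complex.conj_ofReal, AddChar.map_neg_eq_conj, AddChar.map_neg_eq_conj,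
            Complex.conj_conj, dotProduct_sub, sub_eq_neg_add, AddChar.map_add_eq_mul,
            AddChar.map_neg_eq_conj]
          ring
      _ = ∑ x, ∑ y, (u x : ℂ) * u y * ∑ a : ι → F, ψ (a ⬝ᵥ (y - x)) := by
          rw [Finset.sum_comm]
          refine Finset.sum_congr rfl fun x _ => ?_
          rw [Finset.sum_comm]
          simp_rw [Finset.mul_sum]
      _ = ∑ x, (Fintype.card (ι → F) : ℂ) * (u x : ℂ) ^ 2 := by
          refine Finset.sum_congr rfl fun x _ => ?_
          rw [Finset.sum_eq_single x]
          · simp; ring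
          · intro y _ hy
            rw [sum_addChar_dotProduct_eq_zero hψ (sub_ne_zero.2 hy), mul_zero]
          · simp
      _ = _ := by rw [Finset.mul_sum]
  exact_mod_cast h

lemma fourier_avgAdd (ψ : AddChar F ℂ) (T : Finset (ι → F)) (u : (ι → F) → ℝ) (a : ι → F) :
    fourier ψ (avgAdd T u) a = bias ψ T a * fourier ψ u a := by
  have h : ∀ x, ((avgAdd T u x : ℝ) : ℂ) = Finset.expect T fun t => (u (x + t) : ℂ) := by
    intro x
    simp [avgAdd, Finset.expect_eq_sum_div_card]
  simp_rw [fourier, bias, h, Finset.expect_mul, ← Finset.expect_sum_comm]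
  refine Finset.expect_congr rfl fun t _ => ?_
  rw [Finset.mul_sum, ← Equiv.sum_comp (Equiv.addRight t)
    fun x => ψ (a ⬝ᵥ t) * ((u x : ℂ) * ψ (-(a ⬝ᵥ x)))]
  refine Finset.sum_congr rfl fun x _ => ?_
  have h2 : ψ (-(a ⬝ᵥ x)) = ψ (a ⬝ᵥ t) * ψ (-(a ⬝ᵥ (x + t))) := by
    rw [← AddChar.map_add_eq_mul, dotProduct_add]
    congr 1
    ring
  rw [Equiv.coe_addRight, h2]
  ring

lemma fourier_translate_sub (ψ : AddChar F ℂ) (u : (ι → F) → ℝ) (v a : ι → F) :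
    fourier ψ (fun x => u (x + v) - u x) a = (ψ (a ⬝ᵥ v) - 1) * fourier ψ u a := by
  have h := fourier_avgAdd ψ {v} u a
  have h' : avgAdd {v} u = fun x => u (x + v) := funext fun x => Finset.expect_singleton _ _
  simp only [h', bias, Finset.expect_singleton] at h
  rw [sub_mul, one_mul, ← h]
  simp only [fourier, Complex.ofReal_sub, sub_mul, Finset.sum_sub_distrib]

/-- Averaging over `T` is a Fourier multiplier: it preserves vanishing on the large spectrum and at
least halves every other coefficient, so Parseval yields a factor 1/4 per step. -/
lemma sum_iterate_avgAdd_sq_le {ψ : AddChar F ℂ} (hψ : ψ ≠ 1) (T : Finset (ι → F))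
    {u : (ι → F) → ℝ} (hu : ∀ a, 1 / 2 < ‖bias ψ T a‖ → fourier ψ u a = 0) (k : ℕ) :
    ∑ x, (avgAdd T)^[k] u x ^ 2 ≤ (1 / 4) ^ k * ∑ x, u x ^ 2 := by
  induction k generalizing u with
  | zero => simp
  | succ k ih =>
    have h1 := ih (u := avgAdd T u) fun a ha => by rw [fourier_avgAdd, hu a ha, mul_zero]
    have hc : (0 : ℝ) < Fintype.card (ι → F) := by exact_mod_cast Fintype.card_pos
    have h2 : ∑ x, avgAdd T u x ^ 2 ≤ 1 / 4 * ∑ x, u x ^ 2 := by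
      refine le_of_mul_le_mul_left ?_ hc
      rw [mul_left_comm, ← sum_norm_fourier_sq hψ, ← sum_norm_fourier_sq hψ, Finset.mul_sum]
      refine Finset.sum_le_sum fun a _ => ?_
      rw [fourier_avgAdd, norm_mul, mul_pow]
      by_cases ha : 1 / 2 < ‖bias ψ T a‖
      · simp [hu a ha]
      · refine mul_le_mul_of_nonneg_right ?_ (by positivity)
        have := pow_le_pow_left₀ (norm_nonneg _) (not_lt.1 ha) 2
        norm_num at this ⊢
        exact this
    rw [Function.iterate_succ_apply, pow_succ, mul_assoc]
    exact h1.trans (mul_le_mul_of_nonneg_left h2 (by positivity))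

omit [Fintype F] [DecidableEq ι] in
lemma surjective_dotProduct {κ : Type*} [Fintype κ] {a : κ → ι → F} (ha : LinearIndependent F a) :
    Function.Surjective (Matrix.mulVecLin (Matrix.of a)) := by
  rw [← LinearMap.range_eq_top]
  refine Submodule.eq_top_of_finrank_eq ?_
  have h : (Matrix.of a).rank = Fintype.card κ := LinearIndependent.rank_matrix ha
  rw [Module.finrank_fintype_fun_eq_card]
  exact h

/-- The coordinates `a j ⬝ᵥ x`, for linearly independent `a j`, are independent and uniform. -/
lemma sum_prod_dotProduct {κ : Type*} [Fintype κ] [DecidableEq κ] {a : κ → ι → F}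
    (ha : LinearIndependent F a) (φ : κ → F → ℝ) :
    (Fintype.card F : ℝ) ^ Fintype.card κ * ∑ x, ∏ j, φ j (a j ⬝ᵥ x) =
      Fintype.card (ι → F) * ∏ j, ∑ y, φ j y := by
  have h1 : ∀ w : κ → F, ∑ x, ∏ j, φ j (a j ⬝ᵥ x + w j) = ∑ x, ∏ j, φ j (a j ⬝ᵥ x) := by
    intro w
    obtain ⟨z, hz⟩ := surjective_dotProduct ha w
    rw [← Equiv.sum_comp (Equiv.addRight z) fun x => ∏ j, φ j (a j ⬝ᵥ x)]
    refine Finset.sum_congr rfl fun x _ => Finset.prod_congr rfl fun j _ => ?_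
    rw [Equiv.coe_addRight, dotProduct_add, ← hz]
    rfl
  calc (Fintype.card F : ℝ) ^ Fintype.card κ * ∑ x, ∏ j, φ j (a j ⬝ᵥ x)
      -- By linear independence every shift `w` comes from a translation of `x`, so averaging over
      -- all `w` is free and decouples the factors.
      = ∑ w : κ → F, ∑ x, ∏ j, φ j (a j ⬝ᵥ x + w j) := by simp [h1]
    _ = ∑ x, ∑ w : κ → F, ∏ j, φ j (a j ⬝ᵥ x + w j) := Finset.sum_comm
    _ = ∑ x : ι → F, ∏ j, ∑ y, φ j y := by
        refine Finset.sum_congr rfl fun x _ => ?_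
        rw [← Fintype.prod_sum fun j y => φ j (a j ⬝ᵥ x + y)]
        exact Finset.prod_congr rfl fun j _ => Equiv.sum_comp (Equiv.addLeft (a j ⬝ᵥ x)) _
    _ = _ := by simp

/-- Chang's inequality: a linearly independent set of large Fourier coefficients of a set of
density `τ` has size `O(log (1 / τ))`. -/
lemma card_le_of_lt_norm_bias {κ : Type*} [Fintype κ] [DecidableEq κ] {ψ : AddChar F ℂ}
    (hψ : ψ ≠ 1) {T : Finset (ι → F)} (hT : T.Nonempty) {a : κ → ι → F}
    (ha : LinearIndependent F a) (hbias : ∀ j, 1 / 2 < ‖bias ψ T (a j)‖) :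
    (Fintype.card κ : ℝ) ≤ 8 * Real.log (Fintype.card (ι → F) / T.card) := by
  have hTc : (0 : ℝ) < T.card := by exact_mod_cast hT.card_pos
  have hFc : (0 : ℝ) < Fintype.card F := by exact_mod_cast Fintype.card_pos
  have hGc : (0 : ℝ) < Fintype.card (ι → F) := by exact_mod_cast Fintype.card_pos
  -- Phases that rotate each coefficient to a positive real, so that every `X j` has mean above 1/2
  -- on `T` but mean zero on `F`.
  set c : κ → ℂ := fun j => conj (bias ψ T (a j)) / ‖bias ψ T (a j)‖ with hc
  have hb0 : ∀ j, (‖bias ψ T (a j)‖ : ℂ) ≠ 0 := fun j => by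
    have := hbias j
    exact_mod_cast (by linarith : (0 : ℝ) < ‖bias ψ T (a j)‖).ne'
  have hcn : ∀ j, ‖c j‖ = 1 := fun j => by
    have := hb0 j
    simp only [hc, norm_div, RCLike.norm_conj, Complex.norm_real, norm_norm]
    exact div_self (by exact_mod_cast this)
  set X : κ → F → ℝ := fun j y => (c j * ψ y).re with hX
  have hX1 : ∀ j y, |X j y| ≤ 1 := fun j y =>
    (Complex.abs_re_le_norm _).trans (by simp [hcn])
  have hX0 : ∀ j, ∑ y, X j y = 0 := fun j => by
    rw [hX, ← Complex.re_sum, ← Finset.mul_sum, AddChar.sum_eq_zero_of_ne_one hψ]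
    simp
  have hXT : ∀ j, T.card * (1 / 2 : ℝ) ≤ ∑ t ∈ T, X j (a j ⬝ᵥ t) := fun j => by
    have h1 : ∑ t ∈ T, X j (a j ⬝ᵥ t) = (c j * (T.card * bias ψ T (a j))).re := by
      rw [hX, ← Complex.re_sum, ← Finset.mul_sum, bias, ← nsmul_eq_mul, Finset.card_smul_expect]
    have h2 : c j * (T.card * bias ψ T (a j)) = ((T.card * ‖bias ψ T (a j)‖ : ℝ) : ℂ) := by
      have := hb0 j
      rw [hc]
      push_cast
      field_simp
      rw [mul_comm, ← Complex.mul_conj']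
      ring
    rw [h1, h2, Complex.ofReal_re]
    exact mul_le_mul_of_nonneg_left (hbias j).le hTc.le
  -- Jensen bounds the exponential moment over `T` from below; independence over the whole space
  -- bounds it above via cosh(1/2) ≤ e^(1/8).
  have hlow : T.card * Real.exp (Fintype.card κ / 4) ≤
      ∑ t ∈ T, Real.exp (1 / 2 * ∑ j, X j (a j ⬝ᵥ t)) := by
    have hJ := convexOn_exp.map_sum_le (t := T) (w := fun _ => (T.card : ℝ)⁻¹)
      (p := fun t => 1 / 2 * ∑ j, X j (a j ⬝ᵥ t)) (fun _ _ => by positivity)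
      (by simp [hTc.ne']) (fun _ _ => Set.mem_univ _)
    simp only [smul_eq_mul, ← Finset.mul_sum] at hJ
    rw [Finset.sum_comm, inv_mul_eq_div, inv_mul_eq_div, le_div_iff₀ hTc, mul_comm] at hJ
    refine le_trans (mul_le_mul_of_nonneg_left (Real.exp_le_exp.2 ?_) hTc.le) hJ
    rw [le_div_iff₀ hTc]
    have : ∑ _j : κ, T.card * (1 / 2 : ℝ) ≤ ∑ j, ∑ t ∈ T, X j (a j ⬝ᵥ t) :=
      Finset.sum_le_sum fun j _ => hXT j
    rw [Finset.sum_const, Finset.card_univ, nsmul_eq_mul] at this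
    linarith
  have hupp : ∑ t ∈ T, Real.exp (1 / 2 * ∑ j, X j (a j ⬝ᵥ t)) ≤
      Fintype.card (ι → F) * Real.exp (Fintype.card κ / 8) := by
    calc _ ≤ ∑ x, Real.exp (1 / 2 * ∑ j, X j (a j ⬝ᵥ x)) :=
          Finset.sum_le_sum_of_subset_of_nonneg (Finset.subset_univ _)
            fun _ _ _ => (Real.exp_pos _).le
      _ ≤ ∑ x, ∏ j, (Real.cosh (1 / 2) + X j (a j ⬝ᵥ x) * Real.sinh (1 / 2)) := by
          refine Finset.sum_le_sum fun x _ => ?_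
          rw [Finset.mul_sum, Real.exp_sum]
          refine Finset.prod_le_prod (fun _ _ => (Real.exp_pos _).le) fun j _ => ?_
          rw [mul_comm]
          exact Real.exp_mul_le_cosh_add_mul_sinh (hX1 _ _) _
      _ = Fintype.card (ι → F) * Real.cosh (1 / 2) ^ Fintype.card κ := by
          have h := sum_prod_dotProduct ha fun j y => Real.cosh (1 / 2) + X j y * Real.sinh (1 / 2)
          simp_rw [Finset.sum_add_distrib, ← Finset.sum_mul, hX0] at h
          simp only [Finset.sum_const, Finset.card_univ, nsmul_eq_mul, zero_mul, add_zero,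
            Finset.prod_const, mul_pow] at h
          refine mul_left_cancel₀ (pow_pos hFc (Fintype.card κ)).ne' (h.trans ?_)
          ring
      _ ≤ _ := by
          refine mul_le_mul_of_nonneg_left ?_ hGc.le
          refine (pow_le_pow_left₀ (Real.cosh_pos _).le (Real.cosh_le_exp_half_sq _) _).trans ?_
          rw [← Real.exp_nat_mul]
          exact (Real.exp_le_exp.2 (by ring_nf; rfl))
  have h := hlow.trans hupp
  have h2 : Real.exp (Fintype.card κ / 8) ≤ Fintype.card (ι → F) / T.card := by
    rw [le_div_iff₀ hTc]
    have h3 : Real.exp ((Fintype.card κ : ℝ) / 4) =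
        Real.exp (Fintype.card κ / 8) * Real.exp (Fintype.card κ / 8) := by
      rw [← Real.exp_add]; ring_nf
    rw [h3] at h
    refine le_of_mul_le_mul_right (le_trans (le_of_eq ?_) h) (Real.exp_pos (Fintype.card κ / 8))
    ring
  have h4 := (Real.le_log_iff_exp_le (by positivity)).2 h2
  linarith

/-- The common kernel of the large Fourier coefficients of a dense set has small codimension. -/
lemma exists_submodule_annihilating_spectrum {ψ : AddChar F ℂ} (hψ : ψ ≠ 1) {T : Finset (ι → F)}
    (hT : T.Nonempty) :
    ∃ V : Submodule F (ι → F),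
      (Module.finrank F ((ι → F) ⧸ V) : ℝ) ≤
        8 * Real.log (Fintype.card (ι → F) / T.card) ∧
      ∀ v ∈ V, ∀ a, 1 / 2 < ‖bias ψ T a‖ → a ⬝ᵥ v = 0 := by
  classical
  -- Chang's inequality bounds the size of a basis drawn from the spectrum, and a vector orthogonal
  -- to that basis is orthogonal to the whole spectrum.
  obtain ⟨b, hbs, hspan, hli⟩ := exists_linearIndependent F {a | 1 / 2 < ‖bias ψ T a‖}
  have hchang := card_le_of_lt_norm_bias hψ hT hli fun j => hbs j.2
  set L := Matrix.mulVecLin (Matrix.of fun (j : b) => (j : ι → F))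
  refine ⟨LinearMap.ker L, le_trans ?_ hchang, fun v hv a ha => ?_⟩
  · rw [L.quotKerEquivRange.finrank_eq]
    have := (Submodule.finrank_le (LinearMap.range L)).trans_eq
      (Module.finrank_fintype_fun_eq_card F)
    exact_mod_cast this
  · have ha' : a ∈ Submodule.span F b := hspan ▸ Submodule.subset_span ha
    have hle : Submodule.span F b ≤ LinearMap.ker ((dotProductBilin F F).flip v) :=
      Submodule.span_le.2 fun x hx => congrFun (LinearMap.mem_ker.1 hv) ⟨x, hx⟩
    exact hle ha'

end Fourier

end KelleyMeka

namespace KelleyMeka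

/-! ### From almost periods to a subspace -/

section AlmostPeriodicity

lemma iterate_avgAdd_translate_sub {G : Type*} [AddCommGroup G] (T : Finset G) (h : G → ℝ)
    (v : G) (k : ℕ) :
    (avgAdd T)^[k] (fun x => h (x + v) - h x) =
      fun x => (avgAdd T)^[k] h (x + v) - (avgAdd T)^[k] h x := by
  induction k with
  | zero => rfl
  | succ k ih =>
    rw [Function.iterate_succ_apply', ih]
    funext x
    simp only [Function.iterate_succ_apply', avgAdd, Finset.expect_sub_distrib]
    congr 1
    exact Finset.expect_congr rfl fun t _ => by rw [add_right_comm]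

variable {F : Type*} [Field F] [Fintype F] {ι : Type*} [Fintype ι] [DecidableEq ι]

/-- The uniform probability weight on `B`. -/
noncomputable def unif (B : Finset (ι → F)) [DecidablePred (· ∈ B)] (x : ι → F) : ℝ :=
  if x ∈ B then (B.card : ℝ)⁻¹ else 0

/-- Replacing h = `avgSub B u` by its `k`-fold average over `T` is paid for twice, once on `B` and
once on its translate by `v`. The smoothed function changes by at most `e` along `V`, by
Cauchy–Schwarz and the L² decay. The term `2 * δ / β` is the sup of `unif B` times the size of an
exceptional set. -/
lemma exists_submodule_almost_periodic [DecidableEq (ι → F)] {B : Finset (ι → F)}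
    (hB : B.Nonempty) {u : (ι → F) → ℝ}
    (hu : ∀ x, u x ∈ Set.Icc 0 1) {k K : ℕ} (hK : 0 < K) {η δ β e : ℝ} (hη : 0 ≤ η) (he : 0 ≤ e)
    (hβ : β = B.card / Fintype.card (ι → F))
    (hδ : 4 * Real.exp (-(K * η ^ 2 / 2)) ≤ δ) (hk : (1 / 4) ^ k ≤ e ^ 2 * β) :
    ∃ V : Submodule F (ι → F),
      (Module.finrank F ((ι → F) ⧸ V) : ℝ) ≤ 8 * Real.log (2 / β ^ K) ∧
      ∀ v ∈ V, ∑ x, unif B x * avgSub B u x - 2 * (k * (2 * η + 2 * δ / β)) - e ≤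
        ∑ x, unif B x * avgSub B u (x + v) := by
  have hBc : (0 : ℝ) < B.card := by exact_mod_cast hB.card_pos
  have hGc : (0 : ℝ) < Fintype.card (ι → F) := by exact_mod_cast Fintype.card_pos
  have hβ0 : 0 < β := by rw [hβ]; positivity
  obtain ⟨ψ, hψ1⟩ := (AddChar.exists_apply_ne_zero (α := F) (a := 1)).2 one_ne_zero
  have hψ : ψ ≠ 1 := fun h => hψ1 (by rw [h]; rfl)
  obtain ⟨T, hT, hTcard, hTper⟩ := exists_almost_periods hB hu hK hη hδ
  have hTc : (0 : ℝ) < T.card := by exact_mod_cast hT.card_pos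
  obtain ⟨V, hVcodim, hV⟩ := exists_submodule_annihilating_spectrum hψ hT
  set h := avgSub B u with hh
  have hh01 : ∀ x, h x ∈ Set.Icc 0 1 := avgSub_mem_Icc hB hu
  have hw0 : ∀ x, 0 ≤ unif B x := fun x => by unfold unif; positivity
  have hwM : ∀ x, unif B x ≤ (B.card : ℝ)⁻¹ := fun x => by
    unfold unif; split_ifs <;> [rfl; positivity]
  have hw1 : ∑ x, unif B x = 1 := by simp [unif, hBc.ne']
  have hw2 : ∑ x, unif B x ^ 2 = (B.card : ℝ)⁻¹ := by
    simp [unif, ite_pow, sq, hBc.ne']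
  have hM : (B.card : ℝ)⁻¹ * (2 * δ * Fintype.card (ι → F)) = 2 * δ / β := by
    rw [hβ]; field_simp
  refine ⟨V, hVcodim.trans ?_, fun v hv => ?_⟩
  · refine mul_le_mul_of_nonneg_left (Real.log_le_log (by positivity) ?_) (by norm_num)
    rw [hβ, div_pow, div_div_eq_mul_div, div_le_div_iff₀ hTc (by positivity)]
    linarith
  · have h1 : ∀ w : (ι → F) → ℝ, (∀ x, 0 ≤ w x) → (∀ x, w x ≤ (B.card : ℝ)⁻¹) → ∑ x, w x = 1 →
        |∑ x, w x * ((avgAdd T)^[k] h x - h x)| ≤ k * (2 * η + 2 * δ / β) := by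
      intro w a b c
      rw [← hM]
      exact abs_sum_mul_iterate_avgAdd_sub_le hT hh01 (by positivity) hTper k a b c
    have h2 := h1 (unif B) hw0 hwM hw1
    have h3 := h1 (fun x => unif B (x - v)) (fun _ => hw0 _) (fun _ => hwM _)
      ((Equiv.sum_comp (Equiv.subRight v) _).trans hw1)
    have h3' : ∑ x, unif B (x - v) * ((avgAdd T)^[k] h x - h x) =
        ∑ x, unif B x * ((avgAdd T)^[k] h (x + v) - h (x + v)) := by
      rw [← Equiv.sum_comp (Equiv.addRight v)]
      simp
    have h4 : |∑ x, unif B x * ((avgAdd T)^[k] h (x + v) - (avgAdd T)^[k] h x)| ≤ e := by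
      have h5 : ∑ x, ((avgAdd T)^[k] h (x + v) - (avgAdd T)^[k] h x) ^ 2 ≤
          (1 / 4) ^ k * Fintype.card (ι → F) := by
        have := sum_iterate_avgAdd_sq_le hψ T (u := fun x => h (x + v) - h x) (fun a ha => by
          rw [fourier_translate_sub, hV v hv a ha]; simp) k
        rw [iterate_avgAdd_translate_sub] at this
        refine this.trans (mul_le_mul_of_nonneg_left ?_ (by positivity))
        refine (Finset.sum_le_card_nsmul Finset.univ _ 1 fun x _ => ?_).trans_eq (by simp)
        rw [sq_le_one_iff_abs_le_one, abs_le]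
        have a1 := hh01 x
        have a2 := hh01 (x + v)
        constructor <;> linarith [a1.1, a1.2, a2.1, a2.2]
      refine abs_le_of_sq_le_sq ?_ he
      refine (Finset.sum_mul_sq_le_sq_mul_sq _ _ _).trans ?_
      rw [hw2]
      refine (mul_le_mul_of_nonneg_left h5 (by positivity)).trans ?_
      refine (mul_le_mul_of_nonneg_left (mul_le_mul_of_nonneg_right hk hGc.le)
        (by positivity)).trans_eq ?_
      rw [hβ]
      field_simp
    rw [h3'] at h3
    simp_rw [mul_sub, Finset.sum_sub_distrib] at h2 h3 h4
    rw [abs_le] at h2 h3 h4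
    linarith [h2.1, h2.2, h3.1, h3.2, h4.1, h4.2]

/-- A pair count in `B` is almost invariant under translation by a subspace whose codimension is
at most the fourth power of the logarithm of the density of `B`. -/
lemma exists_submodule_codim_le_log_pow {δ₀ : ℝ} (hδ₀ : 0 < δ₀) (hδ₁ : δ₀ ≤ 1) :
    ∃ D : ℝ, 0 < D ∧ ∀ (F : Type*) [Field F] [Fintype F] (ι : Type*) [Fintype ι] [DecidableEq ι]
      [DecidableEq (ι → F)] (B : Finset (ι → F)) (β : ℝ) (u : (ι → F) → ℝ), B.Nonempty →
      β = B.card / Fintype.card (ι → F) → (∀ x, u x ∈ Set.Icc 0 1) →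
      ∃ V : Submodule F (ι → F),
        (Module.finrank F ((ι → F) ⧸ V) : ℝ) ≤ D * Real.log (2 / β) ^ 4 ∧
        ∀ v ∈ V, ∑ x, unif B x * avgSub B u x - δ₀ ≤ ∑ x, unif B x * avgSub B u (x + v) := by
  have hl9 : 0 ≤ Real.log (9 / δ₀ ^ 2) := Real.log_nonneg (by
    rw [le_div_iff₀ (by positivity)]; nlinarith)
  have hl48 : 0 ≤ Real.log (48 / δ₀) := Real.log_nonneg (by
    rw [le_div_iff₀ (by positivity)]; linarith)
  set D₁ := 1 + 2 * Real.log (9 / δ₀ ^ 2) with hD₁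
  set D₂ := D₁ + 2 with hD₂
  set D₃ := 1 + 2 * Real.log (48 / δ₀) + D₂ with hD₃
  set D₄ := 288 * D₂ ^ 2 * D₃ / δ₀ ^ 2 + 8 with hD₄
  have hD₁0 : 0 < D₁ := by positivity
  have hD₂0 : 0 < D₂ := by positivity
  have hD₃0 : 0 < D₃ := by positivity
  have hD₄0 : 0 < D₄ := by positivity
  refine ⟨8 * (8 + D₄), by positivity, ?_⟩
  intro F _ _ ι _ _ _ B β u hB hβ hu
  have hBc : (0 : ℝ) < B.card := by exact_mod_cast hB.card_pos
  have hGc : (0 : ℝ) < Fintype.card (ι → F) := by exact_mod_cast Fintype.card_pos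
  have hβ0 : 0 < β := by rw [hβ]; positivity
  have hβ1 : β ≤ 1 := by
    rw [hβ, div_le_one hGc]; exact_mod_cast Finset.card_le_univ B
  set ℓ := Real.log (2 / β) with hℓ
  have hlβ : Real.log (1 / β) = ℓ - Real.log 2 := by
    rw [hℓ, Real.log_div one_ne_zero hβ0.ne', Real.log_div two_ne_zero hβ0.ne', Real.log_one]
    ring
  have hlog2 := Real.log_two_gt_d9
  have hlβ0 : 0 ≤ Real.log (1 / β) := Real.log_nonneg (by rw [le_div_iff₀ hβ0]; linarith)
  have hℓ2 : 1 / 2 ≤ ℓ := by linarith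
  have hℓ3 : 1 ≤ 8 * ℓ ^ 3 := by
    have := pow_le_pow_left₀ (by norm_num) hℓ2 3; linarith
  have hk0 : 0 < D₁ * ℓ := by positivity
  -- Large enough that 4^(-k) ≤ (δ₀/3)² β.
  set k := ⌈D₁ * ℓ⌉₊ with hk
  have hkpos : 0 < k := Nat.ceil_pos.2 hk0
  have hkpos' : (0 : ℝ) < k := by exact_mod_cast hkpos
  have hk1 : D₁ * ℓ ≤ k := Nat.le_ceil _
  have hk2 : k ≤ D₂ * ℓ := by
    have := Nat.ceil_lt_add_one hk0.le
    rw [hD₂, add_mul]; linarith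
  have hK0 : 0 < 288 * k ^ 2 / δ₀ ^ 2 * (D₃ * ℓ) := by positivity
  -- With η = δ₀/(12k) this gives Kη²/2 ≥ log(48k/(δ₀β)), the sampling requirement. Since k is of
  -- order ℓ, K is of order ℓ³, and the codimension is of order Kℓ.
  set K := ⌈288 * k ^ 2 / δ₀ ^ 2 * (D₃ * ℓ)⌉₊ with hK
  have hKpos : 0 < K := Nat.ceil_pos.2 hK0
  have hK1 : 288 * k ^ 2 / δ₀ ^ 2 * (D₃ * ℓ) ≤ K := Nat.le_ceil _
  have hK2 : K ≤ D₄ * ℓ ^ 3 := by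
    have h1 := Nat.ceil_lt_add_one hK0.le
    have h2 : 288 * k ^ 2 / δ₀ ^ 2 * (D₃ * ℓ) ≤ 288 * (D₂ * ℓ) ^ 2 / δ₀ ^ 2 * (D₃ * ℓ) := by
      gcongr
    have h3 : 288 * (D₂ * ℓ) ^ 2 / δ₀ ^ 2 * (D₃ * ℓ) = 288 * D₂ ^ 2 * D₃ / δ₀ ^ 2 * ℓ ^ 3 := by ring
    rw [hD₄, add_mul]
    linarith
  -- Error budget: 2k(2η + 2δ/β) = 2δ₀/3 and e = δ₀/3, in total δ₀.
  obtain ⟨V, hVcodim, hV⟩ := exists_submodule_almost_periodic (k := k) (K := K)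
    (η := δ₀ / (12 * k)) (δ := δ₀ * β / (12 * k)) (β := β) (e := δ₀ / 3) hB hu hKpos (by positivity)
    (by positivity) hβ (by
      have h1 : Real.log (48 * k / (δ₀ * β)) ≤ D₃ * ℓ := by
        have h2 : 48 * k / (δ₀ * β) = 48 / δ₀ * (k * (1 / β)) := by field_simp
        rw [h2, Real.log_mul (by positivity) (by positivity), Real.log_mul (by positivity)
          (by positivity)]
        have h3 : Real.log k ≤ k := (Real.log_le_sub_one_of_pos hkpos').trans (by linarith)
        rw [hD₃]
        nlinarith
      have h2 : Real.log (48 * k / (δ₀ * β)) ≤ K * (δ₀ / (12 * k)) ^ 2 / 2 := by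
        refine h1.trans ?_
        have : 288 * k ^ 2 / δ₀ ^ 2 * (D₃ * ℓ) * (δ₀ / (12 * k)) ^ 2 / 2 = D₃ * ℓ := by
          field_simp; norm_num
        rw [← this]
        gcongr
      have h3 : Real.exp (-(K * (δ₀ / (12 * k)) ^ 2 / 2)) ≤ (48 * k / (δ₀ * β))⁻¹ := by
        rw [← Real.exp_log (show 0 < (48 * k / (δ₀ * β))⁻¹ by positivity), Real.log_inv]
        exact Real.exp_le_exp.2 (neg_le_neg h2)
      refine (mul_le_mul_of_nonneg_left h3 (by norm_num)).trans_eq ?_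
      field_simp; norm_num) (by
      have h1 : Real.log (9 / δ₀ ^ 2 * (1 / β)) ≤ k * Real.log 4 := by
        rw [Real.log_mul (by positivity) (by positivity)]
        have h4 : 1 ≤ Real.log 4 := by
          rw [show (4 : ℝ) = 2 ^ 2 by norm_num, Real.log_pow]; push_cast; linarith
        have h5 : (k : ℝ) ≤ k * Real.log 4 := le_mul_of_one_le_right hkpos'.le h4
        have h6 : Real.log (9 / δ₀ ^ 2) + Real.log (1 / β) ≤ D₁ * ℓ := by
          rw [hD₁]; nlinarith
        linarith
      have h2 : 9 / δ₀ ^ 2 * (1 / β) ≤ 4 ^ k := by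
        rw [← Real.log_le_log_iff (by positivity) (by positivity), Real.log_pow]
        exact h1
      rw [one_div, inv_pow]
      refine (inv_anti₀ (by positivity) h2).trans_eq ?_
      field_simp
      norm_num)
  refine ⟨V, hVcodim.trans ?_, fun v hv => le_trans (le_of_eq ?_) (hV v hv)⟩
  · have h1 : Real.log (2 / β ^ K) = Real.log 2 + K * Real.log (1 / β) := by
      rw [Real.log_div two_ne_zero (by positivity), Real.log_pow, one_div, Real.log_inv]
      ring
    have h2 : K * Real.log (1 / β) ≤ D₄ * ℓ ^ 3 * ℓ :=
      mul_le_mul hK2 (by linarith) hlβ0 (by positivity)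
    have h3 : ℓ ≤ 8 * ℓ ^ 3 * ℓ := le_mul_of_one_le_left (by linarith) hℓ3
    rw [h1]
    have h4 : 8 * (8 + D₄) * ℓ ^ 4 = 8 * (8 * ℓ ^ 3 * ℓ + D₄ * ℓ ^ 3 * ℓ) := by ring
    rw [h4]
    linarith
  · field_simp
    ring

end AlmostPeriodicity

end KelleyMeka

namespace KelleyMeka

/-! ### From a failed mean to popular differences -/

section DensityIncrement

variable {G : Type*} [Fintype G]

lemma density_eq_card [DecidableEq G] (A : Set G) [DecidablePred (· ∈ A)] :
    density A = A.toFinset.card / Fintype.card G := by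
  rw [density, Set.ncard_eq_toFinset_card']

omit [Fintype G] in
lemma ind_apply (A : Set G) [DecidablePred (· ∈ A)] (x : G) :
    ind A x = if x ∈ A then 1 else 0 := by
  rw [ind, Set.indicator_apply]; rfl

lemma sum_ite_mem_eq_sum_toFinset (A : Set G) [DecidablePred (· ∈ A)] (f : G → ℝ) :
    ∑ x, (if x ∈ A then f x else 0) = ∑ x ∈ A.toFinset, f x := by
  rw [← Finset.sum_filter]
  congr 1
  ext
  simp

lemma le_supNorm (f : G → ℝ) (x : G) : f x ≤ supNorm f :=
  (le_abs_self _).trans (le_ciSup (f := fun x => |f x|) (Set.finite_range _).bddAbove x)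

lemma density_pos [Nonempty G] {A : Set G} (hA : A.Nonempty) : 0 < density A := by
  have h1 : 0 < A.ncard := (Set.ncard_pos).2 hA
  have h2 : 0 < Fintype.card G := Fintype.card_pos
  unfold density
  positivity

lemma density_le_one (A : Set G) : density A ≤ 1 := by
  classical
  rw [density_eq_card]
  exact div_le_one_of_le₀ (by exact_mod_cast Finset.card_le_univ _) (Nat.cast_nonneg _)

lemma sum_mu [Nonempty G] {A : Set G} (hA : A.Nonempty) : ∑ x, mu A x = Fintype.card G := by
  classical
  have h := density_pos hA
  have hG : (0 : ℝ) < Fintype.card G := by exact_mod_cast Fintype.card_pos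
  have hA' : (A.toFinset.card : ℝ) = density A * Fintype.card G := by
    rw [density_eq_card]; field_simp
  simp_rw [mu, ← Finset.mul_sum, ind_apply]
  rw [sum_ite_mem_eq_sum_toFinset, Finset.sum_const, nsmul_eq_mul, hA']
  field_simp

lemma sum_sub_one_mul_sub_one {p : G → ℝ} (hp : ∑ x, p x = Fintype.card G) (σ : G ≃ G) :
    ∑ y, (p y - 1) * (p (σ y) - 1) = ∑ y, p y * p (σ y) - Fintype.card G := by
  have h : ∑ y, p (σ y) = Fintype.card G := (Equiv.sum_comp σ p).trans hp
  simp_rw [sub_mul, mul_sub, mul_one, one_mul, Finset.sum_sub_distrib, h, hp]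
  simp

lemma ip_mu_right (f : G → ℝ) (C : Set G) [DecidablePred (· ∈ C)] [Nonempty G]
    (hC : C.Nonempty) : ip f (mu C) = (∑ x ∈ C.toFinset, f x) / C.toFinset.card := by
  classical
  have h := density_pos hC
  have hG : (0 : ℝ) < Fintype.card G := by exact_mod_cast Fintype.card_pos
  have hC' : (0 : ℝ) < C.toFinset.card := by
    exact_mod_cast Finset.card_pos.2 (Set.toFinset_nonempty.2 hC)
  have h1 : ∑ x, f x * mu C x = (density C)⁻¹ * ∑ x ∈ C.toFinset, f x := by
    simp_rw [mu, ind_apply, mul_left_comm _ (_⁻¹ : ℝ), ← Finset.mul_sum,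
      ← sum_ite_mem_eq_sum_toFinset, mul_ite, mul_one, mul_zero]
  rw [ip, Fintype.expect_eq_sum_div_card, h1, density_eq_card]
  field_simp

/-- The power mean inequality on `C`; the even exponent removes absolute values and allows the sum
to be extended to all of `G`. -/
lemma card_mul_pow_le_sum_pow {a : G → ℝ} {C : Finset G} {ε : ℝ} (hε : 0 ≤ ε)
    (h : ε * C.card ≤ |∑ x ∈ C, a x|) {m : ℕ} (hm : 0 < m) :
    C.card * ε ^ (2 * m) ≤ ∑ x, a x ^ (2 * m) := by
  obtain ⟨k, hk⟩ : ∃ k, 2 * m = k + 1 := ⟨2 * m - 1, by omega⟩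
  have heven : ∀ x, |a x| ^ (2 * m) = a x ^ (2 * m) := fun x => (even_two_mul m).pow_abs _
  have h1 : ∑ x ∈ C, a x ^ (2 * m) ≤ ∑ x, a x ^ (2 * m) :=
    Finset.sum_le_sum_of_subset_of_nonneg (Finset.subset_univ _)
      fun x _ _ => (even_two_mul m).pow_nonneg _
  refine le_trans ?_ h1
  rcases C.eq_empty_or_nonempty with rfl | hC
  · simp
  have hc : (0 : ℝ) < C.card := by exact_mod_cast hC.card_pos
  have h2 := pow_sum_div_card_le_sum_pow (s := C) (f := fun x => |a x|) (fun _ _ => abs_nonneg _) k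
  rw [← hk] at h2
  simp_rw [heven] at h2
  refine le_trans ?_ h2
  rw [le_div_iff₀ (by positivity)]
  calc C.card * ε ^ (2 * m) * C.card ^ k = (ε * C.card) ^ (2 * m) := by rw [mul_pow, hk]; ring
    _ ≤ _ := pow_le_pow_left₀ (by positivity) (h.trans (Finset.abs_sum_le_sum_abs _ _)) _

variable [AddCommGroup G] [DecidableEq G]

/-- If `μ_A * μ_A` does not have mean about `1` on a set `C` of density at least `γ`, then some
high moment of `μ_A ∘ μ_A` is large. -/
lemma le_sum_corrCount_pow (A C : Set G) [DecidablePred (· ∈ A)] (hA : A.Nonempty)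
    {γ ε : ℝ} (hγ : 0 < γ) (hC : γ ≤ density C) (hε : 0 < ε)
    (h : ε < |ip (conv (mu A) (mu A)) (mu C) - 1|) {m n : ℕ} (hm : 0 < m)
    (hn : 8 * m / ε ≤ n) (hε1 : ε ≤ 1) (hmγ : 1 ≤ 4 ^ m * γ) :
    (Fintype.card G * density A ^ 2) ^ n * (Fintype.card G * 4 ^ m) ≤
      ∑ x, corrCount A.toFinset x ^ n := by
  classical
  have hα := density_pos hA
  have hG : (0 : ℝ) < Fintype.card G := by exact_mod_cast Fintype.card_pos
  have hm' : (0 : ℝ) < m := by exact_mod_cast hm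
  set N := (Fintype.card G : ℝ)
  set f : G → ℝ := fun x => mu A x - 1 with hf
  set g : G → ℝ := fun x => (∑ y, f y * f (x + y)) / N with hg
  set a : G → ℝ := fun x => (∑ y, f y * f (x - y)) / N with ha
  -- The cross terms vanish because μ_A - 1 has mean zero.
  have hg1 : ∀ x, corrCount A.toFinset x = N * density A ^ 2 * (1 + g x) := by
    intro x
    have h1 := sum_sub_one_mul_sub_one (sum_mu hA) (Equiv.addLeft x)
    have h2 : ∑ y, mu A y * mu A (x + y) = (density A)⁻¹ ^ 2 * corrCount A.toFinset x := by
      rw [corrCount, Finset.mul_sum]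
      refine Finset.sum_congr rfl fun y _ => ?_
      simp only [mu, ind_apply, Set.mem_toFinset]
      ring
    simp only [Equiv.coe_addLeft, h2] at h1
    simp only [hg, hf, h1]
    field_simp
    ring
  have ha1 : ∀ x, conv (mu A) (mu A) x - 1 = a x := by
    intro x
    have h1 := sum_sub_one_mul_sub_one (sum_mu hA) (Equiv.subLeft x)
    simp only [Equiv.subLeft_apply] at h1
    simp only [ha, hf, h1, conv, Fintype.expect_eq_sum_div_card]
    rw [sub_div, div_self hG.ne']
  have hCne : C.Nonempty := by
    rw [Set.nonempty_iff_ne_empty]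
    rintro rfl
    simp [density] at hC
    linarith
  have hCc : (0 : ℝ) < C.toFinset.card := by
    exact_mod_cast Finset.card_pos.2 (Set.toFinset_nonempty.2 hCne)
  have h1 : C.toFinset.card * ε ^ (2 * m) ≤ ∑ x, a x ^ (2 * m) := by
    refine card_mul_pow_le_sum_pow hε.le ?_ hm
    rw [ip_mu_right _ _ hCne] at h
    simp_rw [← ha1, Finset.sum_sub_distrib]
    rw [← le_div_iff₀ hCc, ← abs_of_pos hCc, ← abs_div, sub_div, Finset.sum_const, nsmul_eq_mul, mul_one,
      div_self hCc.ne']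
    exact h.le
  have h2 : ∑ x, a x ^ (2 * m) ≤ ∑ x, g x ^ (2 * m) := by
    simp_rw [ha, hg, div_pow, ← Finset.sum_div]
    exact div_le_div_of_nonneg_right (sum_conv_pow_le_sum_corr_pow f _) (by positivity)
  have h3 : ∀ k, 0 ≤ ∑ x, g x ^ k := fun k => by
    simp_rw [hg, div_pow, ← Finset.sum_div]
    exact div_nonneg (sum_corr_pow_nonneg f _) (by positivity)
  have hmn : 2 * m ≤ n := by
    have h8 : 8 * (m : ℝ) ≤ 8 * m / ε := le_div_self (by positivity) hε hε1
    have : (2 * m : ℝ) ≤ n := by linarith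
    exact_mod_cast this
  have h4 := le_sum_one_add_pow h3 hmn
  have h5 : γ * N ≤ C.toFinset.card := by
    rw [density_eq_card, le_div_iff₀ hG] at hC
    exact hC
  have h6 : N * 4 ^ m ≤ ∑ x, (1 + g x) ^ n := by
    refine le_trans ?_ h4
    -- The binomial gain (4/ε)^(2m) cancels ε^(2m) and leaves 16^m γ ≥ 4^m.
    have h7 : (4 / ε) ^ (2 * m) ≤ ((n : ℝ) / (2 * m : ℕ)) ^ (2 * m) := by
      refine pow_le_pow_left₀ (by positivity) ?_ _
      push_cast
      rw [le_div_iff₀ (by positivity)]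
      refine le_trans (le_of_eq ?_) hn
      ring
    have h8 : γ * N * ε ^ (2 * m) ≤ ∑ x, g x ^ (2 * m) :=
      (mul_le_mul_of_nonneg_right h5 (by positivity)).trans (h1.trans h2)
    refine le_trans ?_ (mul_le_mul h7 h8 (by positivity) (by positivity))
    have h9 : (4 / ε) ^ (2 * m) * (γ * N * ε ^ (2 * m)) = N * 4 ^ m * (4 ^ m * γ) := by
      rw [div_pow, pow_mul 4, show (4 : ℝ) ^ 2 = 4 * 4 by norm_num, mul_pow]
      field_simp
    rw [h9]
    exact le_mul_of_one_le_right (by positivity) hmγ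
  simp_rw [hg1, mul_pow _ (1 + g _), ← Finset.mul_sum]
  exact mul_le_mul_of_nonneg_left h6 (by positivity)

/-- A dense set almost all of whose differences are popular differences of `A`. -/
lemma exists_popular_differences (A C : Set G) [DecidablePred (· ∈ A)] (hA : A.Nonempty)
    {γ ε δ : ℝ} (hγ : 0 < γ) (hC : γ ≤ density C) (hε : 0 < ε) (hε1 : ε ≤ 1) (hδ : 0 < δ)
    (h : ε < |ip (conv (mu A) (mu A)) (mu C) - 1|) {m n : ℕ} (hm : 0 < m)
    (hn : 8 * m / ε ≤ n) (hn' : n ≤ 9 * m / ε) (hmγ : 1 ≤ 4 ^ m * γ) (hmδ : 2 / δ ≤ 2 ^ m) :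
    ∃ B : Finset G, B.Nonempty ∧ Fintype.card G * density A ^ n / 2 ≤ B.card ∧
      ∑ y ∈ B, ∑ z ∈ B, (if corrCount A.toFinset (y - z) ≤
        Fintype.card G * density A ^ 2 * (1 + ε / 16) then (1 : ℝ) else 0) ≤
        δ * (B.card : ℝ) ^ 2 := by
  have hα := density_pos hA
  have hG : (0 : ℝ) < Fintype.card G := by exact_mod_cast Fintype.card_pos
  have hmom := le_sum_corrCount_pow A C hA hγ hC hε h hm hn hε1 hmγ
  refine exists_sift A.toFinset n (by positivity) hδ (by positivity) (lt_of_lt_of_le ?_ hmom)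
  have hA' : (A.toFinset.card : ℝ) = density A * Fintype.card G := by
    rw [density_eq_card]; field_simp
  rw [hA']
  set N := (Fintype.card G : ℝ)
  set α := density A
  -- Here n ≤ 9m/ε and 9/16 < log 2.
  have h1 : (1 + ε / 16) ^ n ≤ 2 ^ m := by
    calc (1 + ε / 16) ^ n ≤ Real.exp (ε / 16) ^ n := by
          refine pow_le_pow_left₀ (by positivity) ?_ n
          linarith [Real.add_one_le_exp (ε / 16)]
      _ = Real.exp (n * (ε / 16)) := by rw [← Real.exp_nat_mul]
      _ ≤ Real.exp (m * Real.log 2) := by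
          refine Real.exp_le_exp.2 ?_
          rw [le_div_iff₀ hε] at hn'
          have := Real.log_two_gt_d9
          have hm' : (0 : ℝ) < m := by exact_mod_cast hm
          nlinarith
      _ = 2 ^ m := by rw [Real.exp_nat_mul, Real.exp_log two_pos]
  -- The sifting hypothesis after normalisation: one factor 2^m pays for the popularity threshold,
  -- the other for 2/δ, and 1/2 is the size requirement.
  have h2 : (1 + ε / 16) ^ n / δ + 1 / 2 < 4 ^ m := by
    have h3 : (1 + ε / 16) ^ n / δ ≤ 4 ^ m / 2 := by
      calc (1 + ε / 16) ^ n / δ ≤ 2 ^ m / δ := by gcongr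
        _ = 2 ^ m * (2 / δ) / 2 := by ring
        _ ≤ 2 ^ m * 2 ^ m / 2 := by gcongr
        _ = 4 ^ m / 2 := by rw [← mul_pow]; norm_num
    have h4 : (1 : ℝ) < 4 ^ m := one_lt_pow₀ (by norm_num) hm.ne'
    linarith
  have h5 : N * (N * α ^ 2 * (1 + ε / 16)) ^ n / δ + N * α ^ n / 2 * (α * N) ^ n =
      (N * α ^ 2) ^ n * (N * ((1 + ε / 16) ^ n / δ + 1 / 2)) := by
    simp_rw [mul_pow]
    ring
  rw [h5]
  gcongr

end DensityIncrement

/-! ### Density increment on a translate of a subspace -/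

section Subspace

variable {F : Type*} [Field F] [Fintype F] {ι : Type*} [Fintype ι] [DecidableEq ι]
  [DecidableEq (ι → F)]

/-- The left side counts, for each `y ∈ A`, the points of `A` in the coset `z + y + V`. -/
lemma sum_corrCount_add_le (A : Set (ι → F)) [DecidablePred (· ∈ A)] (V : Submodule F (ι → F))
    [DecidablePred (· ∈ V)] (z : ι → F) :
    ∑ v with v ∈ V, corrCount A.toFinset (z + v) ≤
      (({v | v ∈ V} : Finset (ι → F)).card : ℝ) * (A.toFinset.card *
        supNorm (conv (ind A) (mu (V : Set (ι → F))))) := by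
  classical
  have hG : (0 : ℝ) < Fintype.card (ι → F) := by exact_mod_cast Fintype.card_pos
  have hVc : (0 : ℝ) < (({v | v ∈ V} : Finset (ι → F)).card : ℝ) := by
    exact_mod_cast Finset.card_pos.2 ⟨0, by simp⟩
  have hdV : density (V : Set (ι → F)) =
      ({v | v ∈ V} : Finset (ι → F)).card / Fintype.card (ι → F) := by
    rw [density_eq_card]
    congr 3
    ext; simp
  have h1 : ∀ x, ∑ v with v ∈ V, (if x + v ∈ A then (1 : ℝ) else 0) =
      ({v | v ∈ V} : Finset (ι → F)).card * conv (ind A) (mu (V : Set (ι → F))) x := by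
    intro x
    simp_rw [conv, Fintype.expect_eq_sum_div_card, mu, hdV, ind_apply]
    have h2 : ∑ v with v ∈ V, (if x + v ∈ A then (1 : ℝ) else 0) =
        ∑ y, (if y ∈ A then (1 : ℝ) else 0) * if x - y ∈ (V : Set (ι → F)) then 1 else 0 := by
      rw [Finset.sum_filter, ← Equiv.sum_comp (Equiv.subRight x)]
      refine Finset.sum_congr rfl fun y _ => ?_
      have h3 : y - x ∈ V ↔ x - y ∈ (V : Set (ι → F)) := by
        rw [SetLike.mem_coe, ← neg_sub, neg_mem_iff]
      simp [h3]
    rw [h2]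
    simp_rw [mul_left_comm _ (_⁻¹ : ℝ), ← Finset.mul_sum]
    field_simp
  have h2 : ∑ v with v ∈ V, corrCount A.toFinset (z + v) =
      ∑ y ∈ A.toFinset, ({v | v ∈ V} : Finset (ι → F)).card *
        conv (ind A) (mu (V : Set (ι → F))) (z + y) := by
    simp_rw [corrCount, ← h1]
    rw [Finset.sum_comm, ← sum_ite_mem_eq_sum_toFinset]
    refine Finset.sum_congr rfl fun y _ => ?_
    simp_rw [Set.mem_toFinset, add_right_comm z _ y]
    split_ifs <;> simp
  rw [h2, ← Finset.mul_sum, ← nsmul_eq_mul (A.toFinset.card)]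
  exact mul_le_mul_of_nonneg_left (Finset.sum_le_card_nsmul _ _ _ fun y _ => le_supNorm _ _)
    hVc.le

/-- Popular differences of `A` that are almost invariant under `V` give a density increment of `A`
on a translate of `V`. -/
lemma density_increment (A : Set (ι → F)) [DecidablePred (· ∈ A)] {B : Finset (ι → F)}
    (hB : B.Nonempty) (V : Submodule F (ι → F)) {r s : ℝ} (hr : 0 ≤ r)
    (hV : ∀ v ∈ V, s ≤ ∑ x, unif B x *
      avgSub B (fun x => if r < corrCount A.toFinset x then 1 else 0) (x + v)) :
    r * s ≤ A.toFinset.card * supNorm (conv (ind A) (mu (V : Set (ι → F)))) := by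
  classical
  set Vf := ({v | v ∈ V} : Finset (ι → F))
  have hVc : (0 : ℝ) < Vf.card := by
    exact_mod_cast Finset.card_pos.2 ⟨0, by simp [Vf]⟩
  have hBc : (0 : ℝ) < B.card := by exact_mod_cast hB.card_pos
  have hw0 : ∀ x, 0 ≤ unif B x := fun x => by unfold unif; positivity
  have hw1 : ∑ x, unif B x = 1 := by simp [unif, hBc.ne']
  set M := A.toFinset.card * supNorm (conv (ind A) (mu (V : Set (ι → F))))
  -- `corrCount` dominates `r` times the indicator of popular differences.
  have h1 : Vf.card * (r * s) ≤ ∑ v ∈ Vf, ∑ x, unif B x * avgSub B (corrCount A.toFinset) (x + v) := by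
    rw [← nsmul_eq_mul]
    refine Finset.card_nsmul_le_sum _ _ _ fun v hv => ?_
    refine (mul_le_mul_of_nonneg_left (hV v (Finset.mem_filter.1 hv).2) hr).trans ?_
    rw [Finset.mul_sum]
    refine Finset.sum_le_sum fun x _ => ?_
    rw [mul_left_comm]
    refine mul_le_mul_of_nonneg_left ?_ (hw0 x)
    rw [avgSub, Finset.mul_expect]
    refine Finset.expect_le_expect fun b _ => ?_
    have := corrCount_nonneg A.toFinset (x + v - b)
    split_ifs with hlt
    · linarith
    · linarith
  have h2 : ∑ v ∈ Vf, ∑ x, unif B x * avgSub B (corrCount A.toFinset) (x + v) ≤ Vf.card * M := by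
    rw [Finset.sum_comm]
    simp_rw [← Finset.mul_sum]
    calc _ ≤ ∑ x, unif B x * (Vf.card * M) := by
          refine Finset.sum_le_sum fun x _ => mul_le_mul_of_nonneg_left ?_ (hw0 x)
          simp_rw [avgSub]
          rw [← Finset.expect_sum_comm]
          refine Finset.expect_le hB fun b _ => ?_
          simp_rw [add_sub_right_comm]
          exact sum_corrCount_add_le A V (x - b)
      _ = _ := by rw [← Finset.sum_mul, hw1, one_mul]
  exact le_of_mul_le_mul_left (h1.trans h2) hVc

end Subspace

end KelleyMeka

/-! ### Choice of parameters and conclusion -/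

namespace KelleyMeka

/-- Exponents for the moment argument, of size `O_ε(log (2 / γ))`. -/
lemma exists_exponents {ε : ℝ} (hε : 0 < ε) (hε1 : ε ≤ 1) :
    ∃ D : ℝ, 0 < D ∧ ∀ γ : ℝ, 0 < γ → γ ≤ 1 → ∃ m n : ℕ, 0 < m ∧ 8 * m / ε ≤ n ∧ n ≤ 9 * m / ε ∧
      1 ≤ 4 ^ m * γ ∧ 2 / (ε / 128) ≤ 2 ^ m ∧ n + 2 ≤ D * Real.log (2 / γ) := by
  have hl : 0 ≤ Real.log (256 / ε) := Real.log_nonneg (by rw [le_div_iff₀ hε]; linarith)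
  -- As ℓ ≥ 1/2, this makes Eℓ ≥ 2 log(256/ε), enough for 2^m ≥ 256/ε; the summand 1 serves 4^m γ ≥
  -- 1.
  set E := 1 + 4 * Real.log (256 / ε) with hE
  have hE0 : 0 < E := by positivity
  refine ⟨11 * (E + 2) / ε, by positivity, fun γ hγ hγ1 => ?_⟩
  have hlog2 := Real.log_two_gt_d9
  have hγlog : Real.log (1 / γ) = Real.log (2 / γ) - Real.log 2 := by
    rw [Real.log_div one_ne_zero hγ.ne', Real.log_div two_ne_zero hγ.ne', Real.log_one]
    ring
  have hγ0 : 0 ≤ Real.log (1 / γ) := Real.log_nonneg (by rw [le_div_iff₀ hγ]; linarith)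
  set ℓ := Real.log (2 / γ)
  have hℓ : 1 / 2 ≤ ℓ := by linarith
  have h0 : 0 < E * ℓ := by positivity
  have hm1 : E * ℓ ≤ (⌈E * ℓ⌉₊ : ℝ) := Nat.le_ceil _
  have hm2 : (⌈E * ℓ⌉₊ : ℝ) ≤ (E + 2) * ℓ := by
    have := Nat.ceil_lt_add_one h0.le
    linarith
  have hm0 : 0 < ⌈E * ℓ⌉₊ := Nat.ceil_pos.2 h0
  set m := ⌈E * ℓ⌉₊
  have hm3 : (1 : ℝ) ≤ m := by exact_mod_cast hm0
  have hn0 : 0 ≤ 8 * (m : ℝ) / ε := by positivity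
  have hn1 : 8 * (m : ℝ) / ε ≤ ⌈8 * (m : ℝ) / ε⌉₊ := Nat.le_ceil _
  have hn2 : (⌈8 * (m : ℝ) / ε⌉₊ : ℝ) ≤ 9 * m / ε := by
    have h1 := Nat.ceil_lt_add_one hn0
    have h2 : 1 ≤ m / ε := by rw [le_div_iff₀ hε]; linarith
    have h3 : 9 * m / ε = 8 * m / ε + m / ε := by ring
    linarith
  refine ⟨m, ⌈8 * (m : ℝ) / ε⌉₊, hm0, hn1, hn2, ?_, ?_, ?_⟩
  · have h1 : 1 / γ ≤ 4 ^ m := by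
      rw [← Real.log_le_log_iff (by positivity) (by positivity), Real.log_pow,
        show (4 : ℝ) = 2 ^ 2 by norm_num, Real.log_pow]
      push_cast
      have h2 : ℓ ≤ E * ℓ := le_mul_of_one_le_left (by linarith) (by linarith)
      nlinarith
    rwa [div_le_iff₀ hγ] at h1
  · rw [← Real.log_le_log_iff (by positivity) (by positivity), Real.log_pow,
      show 2 / (ε / 128) = 256 / ε by field_simp; norm_num]
    have h2 : 2 * Real.log (256 / ε) ≤ E * ℓ := by nlinarith
    nlinarith
  · have h2 : (2 : ℝ) ≤ 2 * m / ε := by rw [le_div_iff₀ hε]; nlinarith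
    calc (⌈8 * (m : ℝ) / ε⌉₊ : ℝ) + 2 ≤ 9 * m / ε + 2 * m / ε := by linarith
      _ = 11 * m / ε := by ring
      _ ≤ 11 * ((E + 2) * ℓ) / ε := by gcongr
      _ = _ := by ring

/-- The extra 2 in `n + 2` absorbs log 4, as log 2 ≤ log(2/α). -/
lemma log_two_div_le {α β : ℝ} {n : ℕ} (hα : 0 < α) (hα1 : α ≤ 1) (hβ : α ^ n / 2 ≤ β) :
    Real.log (2 / β) ≤ (n + 2) * Real.log (2 / α) := by
  have h0 : 0 < α ^ n / 2 := by positivity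
  have h1 : Real.log (2 / β) ≤ Real.log (2 / (α ^ n / 2)) :=
    Real.log_le_log (div_pos two_pos (h0.trans_le hβ)) (div_le_div_of_nonneg_left two_pos.le h0 hβ)
  have h2 : Real.log (2 / (α ^ n / 2)) = 2 * Real.log 2 - n * Real.log α := by
    rw [Real.log_div two_ne_zero h0.ne', Real.log_div (by positivity) two_ne_zero, Real.log_pow]
    ring
  have h3 : Real.log (2 / α) = Real.log 2 - Real.log α := Real.log_div two_ne_zero hα.ne'
  have h4 := Real.log_nonpos hα.le hα1
  have h5 := Real.log_two_gt_d9
  have h6 : (0 : ℝ) ≤ n := Nat.cast_nonneg n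
  rw [h3]
  nlinarith [mul_nonneg h6 (by linarith : (0 : ℝ) ≤ Real.log 2)]

lemma sum_unif_mul_avgSub {F : Type*} [Field F] {ι : Type*} [Fintype F]
    [Fintype ι] [DecidableEq ι] [DecidableEq (ι → F)] (B : Finset (ι → F)) (u : (ι → F) → ℝ) :
    ∑ x, unif B x * avgSub B u x = (∑ x ∈ B, ∑ y ∈ B, u (x - y)) / (B.card : ℝ) ^ 2 := by
  simp_rw [unif, avgSub, Finset.expect_eq_sum_div_card, ite_mul, zero_mul]
  rw [Finset.sum_ite_mem, Finset.univ_inter, Finset.sum_div]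
  refine Finset.sum_congr rfl fun x _ => ?_
  rw [sq, ← div_div, inv_mul_eq_div]

end KelleyMeka

theorem proposition3p3 :
    ∃ c : ℝ, 0 < c ∧
      ∀ ε : ℝ, 0 < ε → ε < 1 →
        ∃ K : ℝ, 0 < K ∧
          ∀ (F : Type*) [Field F] [Fintype F] (n : ℕ) (A C : Set (Fin n → F)) (α γ : ℝ),
            A.Nonempty → α = KelleyMeka.density A →
            0 < γ → γ ≤ KelleyMeka.density C →
            |KelleyMeka.ip (KelleyMeka.conv (KelleyMeka.mu A) (KelleyMeka.mu A))
                (KelleyMeka.mu C) - 1| ≤ ε ∨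
            ∃ V : Submodule F (Fin n → F),
              (KelleyMeka.codim V : ℝ) ≤
                K * KelleyMeka.logTwoDiv γ ^ 4 * KelleyMeka.logTwoDiv α ^ 4 ∧
              (1 + c * ε) * α ≤
                KelleyMeka.supNorm
                  (KelleyMeka.conv (KelleyMeka.ind A)
                    (KelleyMeka.mu (V : Set (Fin n → F)))) := by
  classical
  -- Chosen so that 1 + cε ≤ (1 + ε/16)(1 - ε/64): the popularity gain outweighs the two losses of
  -- ε/128, from unpopular pairs and from translation by V.
  refine ⟨1 / 32, by norm_num, fun ε hε hε1 => ?_⟩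
  obtain ⟨D, hD, hexp⟩ := KelleyMeka.exists_exponents hε hε1.le
  obtain ⟨E, hE, hper⟩ := KelleyMeka.exists_submodule_codim_le_log_pow (δ₀ := ε / 128)
    (by positivity) (by linarith)
  refine ⟨E * D ^ 4, by positivity, ?_⟩
  intro F _ _ n A C α γ hA hα hγ hC
  refine or_iff_not_imp_left.2 fun hne => ?_
  rw [not_le] at hne
  obtain ⟨m, k, hm, hk, hk', hmγ, hmε, hkD⟩ := hexp γ hγ (hC.trans (KelleyMeka.density_le_one C))
  obtain ⟨B, hB, hBcard, hBdiff⟩ := KelleyMeka.exists_popular_differences A C hA hγ hC hε hε1.le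
    (δ := ε / 128) (by positivity) hne hm hk hk' hmγ hmε
  rw [← hα] at hBcard hBdiff
  have hα0 : 0 < α := hα ▸ KelleyMeka.density_pos hA
  have hα1 : α ≤ 1 := hα ▸ KelleyMeka.density_le_one A
  have hG : (0 : ℝ) < Fintype.card (Fin n → F) := by exact_mod_cast Fintype.card_pos
  have hBc : (0 : ℝ) < B.card := by exact_mod_cast hB.card_pos
  set r := Fintype.card (Fin n → F) * α ^ 2 * (1 + ε / 16) with hr
  set u : (Fin n → F) → ℝ := fun x => if r < KelleyMeka.corrCount A.toFinset x then 1 else 0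
    with hu
  obtain ⟨V, hVcodim, hV⟩ := hper F (Fin n) B _ u hB rfl fun x => by
    simp only [hu]; split_ifs <;> simp
  have hBu : 1 - ε / 128 ≤ ∑ x, KelleyMeka.unif B x * KelleyMeka.avgSub B u x := by
    have h1 : ∀ x, u x = 1 - if KelleyMeka.corrCount A.toFinset x ≤ r then 1 else 0 := by
      intro x
      simp only [hu, ← not_lt]
      split_ifs <;> simp
    rw [KelleyMeka.sum_unif_mul_avgSub, le_div_iff₀ (by positivity)]
    simp_rw [h1, Finset.sum_sub_distrib]
    simp only [Finset.sum_const, nsmul_eq_mul, mul_one]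
    linarith
  refine ⟨V, ?_, ?_⟩
  · refine hVcodim.trans ?_
    have h1 : α ^ k / 2 ≤ B.card / Fintype.card (Fin n → F) := by
      rw [le_div_iff₀ hG]; linarith
    have hlα : 0 ≤ Real.log (2 / α) := Real.log_nonneg (by rw [le_div_iff₀ hα0]; linarith)
    have h2 : Real.log (2 / (B.card / Fintype.card (Fin n → F))) ≤
        D * Real.log (2 / γ) * Real.log (2 / α) :=
      (KelleyMeka.log_two_div_le hα0 hα1 h1).trans (mul_le_mul_of_nonneg_right hkD hlα)
    have h3 : 0 ≤ Real.log (2 / (B.card / Fintype.card (Fin n → F))) := by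
      refine Real.log_nonneg ?_
      rw [le_div_iff₀ (by positivity), one_mul]
      refine (div_le_one_of_le₀ ?_ hG.le).trans one_le_two
      exact_mod_cast Finset.card_le_univ B
    calc _ ≤ E * (D * Real.log (2 / γ) * Real.log (2 / α)) ^ 4 := by gcongr
      _ = _ := by simp only [KelleyMeka.logTwoDiv]; ring
  · have h1 := KelleyMeka.density_increment A hB V (r := r) (s := 1 - ε / 64) (by positivity)
      fun v hv => le_trans (by linarith) (hV v hv)
    have hA' : (A.toFinset.card : ℝ) = α * Fintype.card (Fin n → F) := by
      rw [hα, KelleyMeka.density_eq_card]; field_simp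
    rw [hA'] at h1
    refine le_of_mul_le_mul_left (le_trans ?_ h1) (mul_pos hα0 hG)
    have h2 : 1 + 1 / 32 * ε ≤ (1 + ε / 16) * (1 - ε / 64) := by nlinarith
    calc α * Fintype.card (Fin n → F) * ((1 + 1 / 32 * ε) * α)
        = Fintype.card (Fin n → F) * α ^ 2 * (1 + 1 / 32 * ε) := by ring
      _ ≤ Fintype.card (Fin n → F) * α ^ 2 * ((1 + ε / 16) * (1 - ε / 64)) := by gcongr
      _ = r * (1 - ε / 64) := by rw [hr]; ring
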